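/- Let $\Bbbk$ be a field and let $S=\Bbbk[x_1,\ldots,x_n]$ be the polynomial ring with the standard grading $\deg(x_i)=1$. For a homogeneous ideal $I\subseteq S$ let $\beta_{i,j}(I)=\dim_{\Bbbk}\big(\operatorname{Tor}_i^S(I,\Bbbk)_j\big)$ be its graded Betti numbers, and let $\beta_{i,\le j}(I)=\sum_{t\le j}\beta_{i,t}(I)$. Let $I\subsetneq S$ be a proper homogeneous ideal, and let $a\ge 1$ and $h\ge 2$ be integers such that $$\beta_{0,j}(I)\le h^{2^{j+a}-3}\qquad\text{for all } j\ge 0.$$ Then, for all integers $i,j\ge 0$, $$\beta_{i,\le i+j}(I)\le \binom{h^{2^{a+j+1}-3}}{i+1}.$$ -/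

import Mathlib

open MvPolynomial

attribute [local instance] MvPolynomial.gradedAlgebra

universe u

namespace GradedTor

variable {k : Type u} [Field k] {n : ℕ}

/-- Let `S = k[x₁, …, xₙ]` be standard graded. For `B` a set with a degree function `deg`, the
free module `B →₀ S` stands for the graded free module `⨁_b S(-deg b)`. `IsHomog deg x d` says
that `x` lies in its component of degree `d`: each coordinate `x b` is zero or a form of
degree `d - deg b`. -/
def IsHomog {B : Type u} (deg : B → ℕ) (x : B →₀ MvPolynomial (Fin n) k) (d : ℕ) : Prop :=
  ∀ b, x b ≠ 0 → ∃ e, deg b + e = d ∧ (x b).IsHomogeneous e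

/-- A graded free resolution
`⋯ → F₂ → F₁ → F₀ → I → 0` over `S = k[x₁, …, xₙ]` of an ideal `I`, where
`F i = ⨁_{b : B i} S(-deg i b)` and all the maps are homogeneous of degree zero. -/
structure GradedFreeResolution (I : Ideal (MvPolynomial (Fin n) k)) where
  /-- The homogeneous basis of `F i`. -/
  B : ℕ → Type u
  /-- The degrees of the basis elements. -/
  deg : ∀ i, B i → ℕ
  /-- The differential `F (i + 1) → F i`. -/
  d : ∀ i, (B (i + 1) →₀ MvPolynomial (Fin n) k) →ₗ[MvPolynomial (Fin n) k]
    (B i →₀ MvPolynomial (Fin n) k)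
  /-- The augmentation `F 0 → I ⊆ S`. -/
  aug : (B 0 →₀ MvPolynomial (Fin n) k) →ₗ[MvPolynomial (Fin n) k] MvPolynomial (Fin n) k
  d_homog : ∀ i b, IsHomog (deg i) (d i (Finsupp.single b 1)) (deg (i + 1) b)
  aug_homog : ∀ b, (aug (Finsupp.single b 1)).IsHomogeneous (deg 0 b)
  range_aug : LinearMap.range aug = I
  exact_zero : LinearMap.range (d 0) = LinearMap.ker aug
  exact_succ : ∀ i, LinearMap.range (d (i + 1)) = LinearMap.ker (d i)

/-- The quotient `Z / W` of two subspaces `W ⊆ Z` of a vector space. -/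
abbrev Subquotient {V : Type u} [AddCommGroup V] [Module k V] (Z W : Submodule k V) : Type u :=
  Z ⧸ W.submoduleOf Z

namespace GradedFreeResolution

variable {I : Ideal (MvPolynomial (Fin n) k)} (F : GradedFreeResolution I)

/-- The differential of `F ⊗_S k`, where `k = S / (x₁, …, xₙ)`. One has `F i ⊗_S k = (B i →₀ k)`,
with basis element `b` in degree `deg i b`, and the matrix of the differential of `F ⊗_S k` is
obtained from that of `d i` by reducing the entries modulo `(x₁, …, xₙ)`, that is, by taking
constant coefficients. -/
noncomputable def dk (i : ℕ) : (F.B (i + 1) →₀ k) →ₗ[k] (F.B i →₀ k) :=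
  Finsupp.linearCombination k fun b =>
    (F.d i (Finsupp.single b 1)).mapRange constantCoeff (map_zero constantCoeff)

/-- The degree `j` component of `F i ⊗_S k`. -/
noncomputable def component (i j : ℕ) : Submodule k (F.B i →₀ k) :=
  Finsupp.supported k k {b | F.deg i b = j}

/-- The cycles of homological degree `i` and internal degree `j` in `F ⊗_S k`. -/
noncomputable def cycles : (i j : ℕ) → Submodule k (F.B i →₀ k)
  | 0, j => F.component 0 j
  | i + 1, j => LinearMap.ker (F.dk i) ⊓ F.component (i + 1) j

/-- The boundaries of homological degree `i` and internal degree `j` in `F ⊗_S k`. -/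
noncomputable def boundaries (i j : ℕ) : Submodule k (F.B i →₀ k) :=
  (F.component (i + 1) j).map (F.dk i)

lemma dk_reduce (i : ℕ) (x : F.B (i + 1) →₀ MvPolynomial (Fin n) k) :
    F.dk i (x.mapRange constantCoeff (map_zero constantCoeff)) =
      (F.d i x).mapRange constantCoeff (map_zero constantCoeff) := by
  induction x using Finsupp.induction_linear with
  | zero => simp
  | add f g hf hg =>
    rw [Finsupp.mapRange_add (map_add constantCoeff), map_add, hf, hg, map_add,
      Finsupp.mapRange_add (map_add constantCoeff)]
  | single b p =>
    have h : Finsupp.single b p = p • Finsupp.single b (1 : MvPolynomial (Fin n) k) := by simp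
    rw [Finsupp.mapRange_single, dk, Finsupp.linearCombination_single, h, map_smul]
    ext c
    simp

lemma dk_mem_component (i j : ℕ) (x : F.B (i + 1) →₀ k) (hx : x ∈ F.component (i + 1) j) :
    F.dk i x ∈ F.component i j := by
  rw [component, Finsupp.mem_supported] at hx
  rw [dk, Finsupp.linearCombination_apply]
  refine Submodule.sum_mem _ fun b hb => Submodule.smul_mem _ _ ?_
  rw [component, Finsupp.mem_supported]
  intro c hc
  rw [Finset.mem_coe, Finsupp.mem_support_iff, Finsupp.mapRange_apply] at hc
  obtain ⟨e, he, hh⟩ := F.d_homog i b c fun h0 => hc (by rw [h0, map_zero])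
  have hb' : F.deg (i + 1) b = j := hx hb
  have he0 : e = 0 := by
    by_contra hne
    refine hc ?_
    rw [constantCoeff_eq]
    exact hh.coeff_eq_zero (by simpa using fun h => hne h.symm)
  change F.deg i c = j
  omega

/-- The boundaries are cycles. -/
lemma boundaries_le_cycles (i j : ℕ) : F.boundaries i j ≤ F.cycles i j := by
  rintro _ ⟨x, hx, rfl⟩
  cases i with
  | zero => exact F.dk_mem_component 0 j x hx
  | succ i =>
    refine ⟨?_, F.dk_mem_component (i + 1) j x hx⟩
    change F.dk i (F.dk (i + 1) x) = 0
    have hlift : x = (x.mapRange (C : k →+* MvPolynomial (Fin n) k) (map_zero C)).mapRange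
        constantCoeff (map_zero constantCoeff) := by
      ext b
      simp
    have h0 : F.d i (F.d (i + 1) (x.mapRange (C : k →+* MvPolynomial (Fin n) k) (map_zero C))) =
        0 := by
      rw [← LinearMap.mem_ker, ← F.exact_succ i]
      exact LinearMap.mem_range_self _ _
    rw [hlift, dk_reduce, dk_reduce, h0]
    simp

/-- `Tor_i^S(I, k)_j`, the degree `j` component of `H_i(F ⊗_S k)`. -/
abbrev Tor (i j : ℕ) : Type u :=
  Subquotient (F.cycles i j) (F.boundaries i j)

end GradedFreeResolution

/-! ### Every homogeneous ideal has a graded free resolution -/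

section existence

variable {B : Type u} {deg : B → ℕ}

/-- The component of degree `d` of an element of `⨁_b S(-deg b)`. -/
noncomputable def comp (deg : B → ℕ) (d : ℕ) :
    (B →₀ MvPolynomial (Fin n) k) →ₗ[k] (B →₀ MvPolynomial (Fin n) k) :=
  Finsupp.lsum k fun b => (Finsupp.lsingle b).comp
    (if deg b ≤ d then homogeneousComponent (d - deg b) else 0)

lemma comp_single (d : ℕ) (b : B) (p : MvPolynomial (Fin n) k) :
    comp deg d (Finsupp.single b p) = Finsupp.single b
      ((if deg b ≤ d then homogeneousComponent (d - deg b) else 0 :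
        MvPolynomial (Fin n) k →ₗ[k] MvPolynomial (Fin n) k) p) := by
  simp [comp]

lemma comp_apply (d : ℕ) (x : B →₀ MvPolynomial (Fin n) k) (b : B) :
    comp deg d x b = (if deg b ≤ d then homogeneousComponent (d - deg b) else 0 :
        MvPolynomial (Fin n) k →ₗ[k] MvPolynomial (Fin n) k) (x b) := by
  classical
  induction x using Finsupp.induction_linear with
  | zero => simp
  | add f g hf hg => rw [map_add, Finsupp.add_apply, Finsupp.add_apply, hf, hg, map_add]
  | single c p =>
    rw [comp_single, Finsupp.single_apply, Finsupp.single_apply]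
    split_ifs with h <;> simp_all

lemma comp_isHomog (d : ℕ) (x : B →₀ MvPolynomial (Fin n) k) :
    IsHomog deg (comp deg d x) d := by
  intro b hb
  rw [comp_apply] at hb ⊢
  split_ifs at hb ⊢ with h
  · exact ⟨d - deg b, by omega, homogeneousComponent_isHomogeneous _ _⟩
  · simp at hb

lemma comp_of_isHomog {x : B →₀ MvPolynomial (Fin n) k} {e : ℕ} (hx : IsHomog deg x e) (d : ℕ) :
    comp deg d x = if e = d then x else 0 := by
  ext1 b
  rw [comp_apply]
  by_cases h0 : x b = 0
  · split_ifs <;> simp [h0]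
  obtain ⟨c, hc, hh⟩ := hx b h0
  split_ifs with h1 h2 h2
  · have : d - deg b = c := by omega
    rw [this, homogeneousComponent_of_mem hh, if_pos rfl]
  · rw [homogeneousComponent_of_mem hh, if_neg (by omega)]; rfl
  · omega
  · rfl

lemma exists_sum_comp (deg : B → ℕ) (x : B →₀ MvPolynomial (Fin n) k) :
    ∃ N, x = ∑ d ∈ Finset.range N, comp deg d x := by
  classical
  induction x using Finsupp.induction_linear with
  | zero => exact ⟨0, by simp⟩
  | add f g hf hg =>
    have mono : ∀ (y : B →₀ MvPolynomial (Fin n) k) (N M : ℕ), N ≤ M →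
        y = ∑ d ∈ Finset.range N, comp deg d y → y = ∑ d ∈ Finset.range M, comp deg d y := by
      intro y N M hNM hy
      rw [← Finset.sum_subset (Finset.range_mono hNM)]
      · exact hy
      · intro d _ hd
        rw [hy, map_sum]
        refine Finset.sum_eq_zero fun e he => ?_
        rw [comp_of_isHomog (comp_isHomog e y), if_neg]
        rintro rfl
        exact hd he
    obtain ⟨N, hN⟩ := hf
    obtain ⟨M, hM⟩ := hg
    refine ⟨max N M, ?_⟩
    simp only [map_add, Finset.sum_add_distrib]
    rw [← mono f N _ (le_max_left _ _) hN, ← mono g M _ (le_max_right _ _) hM]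
  | single b p =>
    refine ⟨deg b + (p.totalDegree + 1), ?_⟩
    rw [Finset.sum_range_add, Finset.sum_eq_zero, zero_add]
    · simp only [comp_single, Nat.le_add_right, if_true, Nat.add_sub_cancel_left]
      rw [← Finsupp.single_finsetSum, sum_homogeneousComponent]
    · intro d hd
      rw [Finset.mem_range] at hd
      rw [comp_single, if_neg (by omega)]
      simp

variable (deg) in
/-- The homogeneous elements of a submodule `K` of `⨁_b S(-deg b)`, with their degrees. -/
abbrev Gens (K : Submodule (MvPolynomial (Fin n) k) (B →₀ MvPolynomial (Fin n) k)) : Type u :=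
  {p : (B →₀ MvPolynomial (Fin n) k) × ℕ // p.1 ∈ K ∧ IsHomog deg p.1 p.2}

variable (deg) in
/-- The map onto `K` from the graded free module on all the homogeneous elements of `K`. -/
noncomputable abbrev cover
    (K : Submodule (MvPolynomial (Fin n) k) (B →₀ MvPolynomial (Fin n) k)) :
    (Gens deg K →₀ MvPolynomial (Fin n) k) →ₗ[MvPolynomial (Fin n) k]
      (B →₀ MvPolynomial (Fin n) k) :=
  Finsupp.linearCombination _ fun p => p.1.1

lemma range_cover {K : Submodule (MvPolynomial (Fin n) k) (B →₀ MvPolynomial (Fin n) k)}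
    (hK : ∀ x ∈ K, ∀ d, comp deg d x ∈ K) : LinearMap.range (cover deg K) = K := by
  apply le_antisymm
  · rw [Finsupp.range_linearCombination, Submodule.span_le]
    rintro _ ⟨p, rfl⟩
    exact p.2.1
  · intro x hx
    obtain ⟨N, hN⟩ := exists_sum_comp deg x
    rw [hN]
    refine Submodule.sum_mem _ fun d _ => ?_
    exact ⟨Finsupp.single ⟨(comp deg d x, d), hK x hx d, comp_isHomog d x⟩ 1, by simp⟩

lemma comp_smul {x : B →₀ MvPolynomial (Fin n) k} {e : ℕ} (hx : IsHomog deg x e) (d : ℕ)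
    (p : MvPolynomial (Fin n) k) :
    comp deg d (p • x) = ((if e ≤ d then homogeneousComponent (d - e) else 0 :
        MvPolynomial (Fin n) k →ₗ[k] MvPolynomial (Fin n) k) p) • x := by
  induction p using MvPolynomial.induction_on' with
  | add p q hp hq => rw [add_smul, map_add, hp, hq, map_add, add_smul]
  | monomial m a =>
    have hm : (monomial m a : MvPolynomial (Fin n) k).IsHomogeneous m.degree :=
      isHomogeneous_monomial a rfl
    have hmx : IsHomog deg ((monomial m a : MvPolynomial (Fin n) k) • x) (m.degree + e) := by
      intro b hb
      rw [Finsupp.smul_apply, smul_eq_mul] at hb ⊢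
      obtain ⟨c, hc, hh⟩ := hx b (right_ne_zero_of_mul hb)
      exact ⟨m.degree + c, by omega, hm.mul hh⟩
    rw [comp_of_isHomog hmx]
    split_ifs with h1 h2 h2
    · rw [homogeneousComponent_of_mem hm, if_pos (by omega)]
    · omega
    · rw [homogeneousComponent_of_mem hm, if_neg (by omega), zero_smul]
    · simp

lemma cover_comp (K : Submodule (MvPolynomial (Fin n) k) (B →₀ MvPolynomial (Fin n) k)) (d : ℕ)
    (x : Gens deg K →₀ MvPolynomial (Fin n) k) :
    cover deg K (comp (fun p => p.1.2) d x) = comp deg d (cover deg K x) := by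
  induction x using Finsupp.induction_linear with
  | zero => simp
  | add f g hf hg => simp only [map_add, hf, hg]
  | single p c =>
    rw [comp_single, Finsupp.linearCombination_single, Finsupp.linearCombination_single,
      comp_smul p.2.2]

end existence

/-- A graded free module together with a graded submodule: the syzygies still to be resolved. -/
structure Stage (k : Type u) [Field k] (n : ℕ) where
  B : Type u
  deg : B → ℕ
  K : Submodule (MvPolynomial (Fin n) k) (B →₀ MvPolynomial (Fin n) k)
  comp_mem : ∀ x ∈ K, ∀ d, comp deg d x ∈ K

/-- One step of the construction: cover `K` by a graded free module, and take the kernel. -/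
noncomputable def Stage.next (s : Stage k n) : Stage k n where
  B := Gens s.deg s.K
  deg p := p.1.2
  K := LinearMap.ker (cover s.deg s.K)
  comp_mem x hx d := by
    rw [LinearMap.mem_ker] at hx ⊢
    rw [cover_comp, hx, map_zero]

/-- The construction starts with `I` as a submodule of the free module `S` of rank one. -/
noncomputable def Stage.start (I : Ideal (MvPolynomial (Fin n) k))
    (hI : I.IsHomogeneous (homogeneousSubmodule (Fin n) k)) : Stage k n where
  B := PUnit
  deg _ := 0
  K := Submodule.comap (Finsupp.lapply PUnit.unit) I
  comp_mem x hx d := by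
    rw [Submodule.mem_comap, Finsupp.lapply_apply] at hx ⊢
    rw [comp_apply, if_pos (Nat.zero_le _)]
    exact homogeneousComponent_mem_of_mem hI hx _

/-- The map from the next free module onto `K`. -/
noncomputable def Stage.map (s : Stage k n) :
    (s.next.B →₀ MvPolynomial (Fin n) k) →ₗ[MvPolynomial (Fin n) k]
      (s.B →₀ MvPolynomial (Fin n) k) :=
  cover s.deg s.K

lemma Stage.map_homog (s : Stage k n) (b : s.next.B) :
    IsHomog s.deg (s.map (Finsupp.single b 1)) (s.next.deg b) := by
  have h : ∀ b : Gens s.deg s.K, IsHomog s.deg (cover s.deg s.K (Finsupp.single b 1)) b.1.2 := by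
    intro b
    rw [Finsupp.linearCombination_single, one_smul]
    exact b.2.2
  exact h b

lemma Stage.range_map (s : Stage k n) : LinearMap.range s.map = s.K :=
  range_cover s.comp_mem

lemma Stage.range_map_next (s : Stage k n) : LinearMap.range s.next.map = LinearMap.ker s.map :=
  s.next.range_map

/-- The iterated construction. -/
noncomputable def Stage.iter (s : Stage k n) : ℕ → Stage k n
  | 0 => s
  | i + 1 => (Stage.iter s i).next

/-- The last map of the resolution, onto `I ⊆ S`. -/
noncomputable def Stage.aug (I : Ideal (MvPolynomial (Fin n) k))
    (hI : I.IsHomogeneous (homogeneousSubmodule (Fin n) k)) :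
    ((Stage.start I hI).next.B →₀ MvPolynomial (Fin n) k) →ₗ[MvPolynomial (Fin n) k]
      MvPolynomial (Fin n) k :=
  LinearMap.comp (M₂ := (Stage.start I hI).B →₀ MvPolynomial (Fin n) k)
    (Finsupp.lapply (α := (Stage.start I hI).B) PUnit.unit) (Stage.start I hI).map

lemma Stage.aug_homog (I : Ideal (MvPolynomial (Fin n) k))
    (hI : I.IsHomogeneous (homogeneousSubmodule (Fin n) k)) (b : (Stage.start I hI).next.B) :
    (Stage.aug I hI (Finsupp.single b 1)).IsHomogeneous ((Stage.start I hI).next.deg b) := by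
  have h := (Stage.start I hI).map_homog b PUnit.unit
  change ((Stage.start I hI).map (Finsupp.single b 1) PUnit.unit).IsHomogeneous _
  by_cases h0 : (Stage.start I hI).map (Finsupp.single b 1) PUnit.unit = 0
  · rw [h0]
    exact isHomogeneous_zero _ _ _
  · obtain ⟨e, he, hh⟩ := h h0
    have he' : e = (Stage.start I hI).next.deg b := (Nat.zero_add e).symm.trans he
    rw [← he']
    exact hh

lemma Stage.range_aug (I : Ideal (MvPolynomial (Fin n) k))
    (hI : I.IsHomogeneous (homogeneousSubmodule (Fin n) k)) :
    LinearMap.range (Stage.aug I hI) = I := by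
  rw [Stage.aug, LinearMap.range_comp, Stage.range_map]
  refine Submodule.map_comap_eq_of_surjective ?_ I
  intro p
  exact ⟨Finsupp.single PUnit.unit p, Finsupp.single_eq_same⟩

lemma Stage.ker_aug (I : Ideal (MvPolynomial (Fin n) k))
    (hI : I.IsHomogeneous (homogeneousSubmodule (Fin n) k)) :
    LinearMap.ker (Stage.aug I hI) = LinearMap.ker (Stage.start I hI).map := by
  ext x
  rw [LinearMap.mem_ker, LinearMap.mem_ker]
  change (Stage.start I hI).map x PUnit.unit = 0 ↔ _
  refine ⟨fun h => ?_, fun h => by rw [h]; rfl⟩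
  ext1 b
  exact h

/-- The standard graded free resolution of a homogeneous ideal, which uses at each step all
the homogeneous elements of the module to be covered as generators. -/
noncomputable def standardResolution (I : Ideal (MvPolynomial (Fin n) k))
    (hI : I.IsHomogeneous (homogeneousSubmodule (Fin n) k)) : GradedFreeResolution I where
  B i := ((Stage.start I hI).iter (i + 1)).B
  deg i := ((Stage.start I hI).iter (i + 1)).deg
  d i := ((Stage.start I hI).iter (i + 1)).map
  aug := Stage.aug I hI
  d_homog i b := ((Stage.start I hI).iter (i + 1)).map_homog b
  aug_homog b := Stage.aug_homog I hI b
  range_aug := Stage.range_aug I hI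
  exact_zero := ((Stage.start I hI).range_map_next).trans (Stage.ker_aug I hI).symm
  exact_succ i := ((Stage.start I hI).iter (i + 1)).range_map_next

/-- The graded Betti number `β_{i,j}(I) = dim_k Tor_i^S(I, k)_j` of a homogeneous ideal `I` of
`S = k[x₁, …, xₙ]`. As usual, `Tor` does not depend on the graded free resolution of `I`. -/
noncomputable def betti (I : Ideal (MvPolynomial (Fin n) k))
    (hI : I.IsHomogeneous (homogeneousSubmodule (Fin n) k)) (i j : ℕ) : ℕ :=
  Module.finrank k ((standardResolution I hI).Tor i j)

/-- `β_{i,≤j}(I) = ∑_{t ≤ j} β_{i,t}(I)`. -/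
noncomputable def bettiLE (I : Ideal (MvPolynomial (Fin n) k))
    (hI : I.IsHomogeneous (homogeneousSubmodule (Fin n) k)) (i j : ℕ) : ℕ :=
  ∑ t ∈ Finset.range (j + 1), betti I hI i t

end GradedTor

/-!
The proof compares `I` with an initial ideal.

*Koszul homology.* For a graded module `N` over `S = k[x₁, …, xₙ]`, let `H_i(N)_t` be the homology
of the Koszul complex of `x₁, …, xₙ` with coefficients in `N`, in homological degree `i` and
internal degree `t`. This complex is acyclic for `N = S`, because it splits into multidegrees `μ`,
and `e_a ∧ -` is a contracting homotopy there as soon as `x_a` divides `x^μ` (`exists_koszul_eq`).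
Shifting dimensions along a graded free resolution of `I`, one finds that `Tor_i(I, k)_t` embeds
into `H_i(I)_t`, which is finite dimensional (`GradedFreeResolution.finrank_Tor_le`). For `i = 0`
the opposite inequality is needed as well (`GradedFreeResolution.koszulDim_zero_le_finrank_Tor`).

*Degeneration.* Let `J` be the initial ideal of `I` for a monomial order. The components of the
Koszul complexes of `I` and `J` have the same dimensions, and the leading multihomogeneous
components of the cycles of `I` are cycles of `J`. Comparing dimensions gives `dim H_i(I)_t ≤ dim
H_i(J)_t` and `dim H_0(J)_t ≤ dim H_0(I)_t + dim H_1(J)_t` (`koszulDim_idealPiece_le`,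
`koszulDim_zero_initial_le`).

*Monomial ideals.* If `J` is generated by `N` monomials, then `∑_t dim H_i(J)_t ≤ N.choose (i + 1)`,
by induction on `N` (`sum_koszulDim_multiples_le`). Moreover, for `t ≤ i + j` the space `H_i(J)_t`
only involves the components of `J` of degree at most `j`, so that one may take for `N` the number
`N_j` of minimal generators of `J` of degree at most `j` (`sum_koszulDim_le_choose`). Hence
`β_{i,≤i+j}(I) ≤ N_j.choose (i + 1)`.

*Counting.* The minimal generators of `J` of degree `d + 1` are counted by `H_0(J)_{d+1}`, so the
two facts above give `N_{d+1} ≤ N_d + β_{0,d+1}(I) + N_d.choose 2` (`card_minGens_initial_succ_le`).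
Since `N_0 = 0`, the hypothesis on `β_{0,j}(I)` turns this into `N_j ≤ h^{2^{a+j+1} - 3}`
(`le_pow_of_recursion`).
-/

namespace GradedTor

/-! ### Dimensions of subquotients -/

section LinearAlgebra

open Module

variable {k : Type*} [Field k] {V V' U : Type*} [AddCommGroup V] [Module k V]
  [AddCommGroup V'] [Module k V'] [AddCommGroup U] [Module k U]

/-- The dimension of `(Z + W) / W`, which is the subquotient `Z / W` when `W ≤ Z`. -/
noncomputable def relDim (Z W : Submodule k V) : ℕ :=
  finrank k (Z.map W.mkQ)

/-- A linear correspondence `Γ` between `V` and `V'` which is defined on all of `Z`, takes values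
in `Z'`, and relates elements of `W'` to elements of `W` only, embeds `Z / W` into `Z' / W'`. -/
lemma exists_injective_of_correspondence {Z W : Submodule k V} {Z' W' : Submodule k V'}
    (Γ : Submodule k U) (α : U →ₗ[k] V) (β : U →ₗ[k] V')
    (h₁ : ∀ z ∈ Z, ∃ w ∈ Γ, α w = z ∧ β w ∈ Z')
    (h₂ : ∀ w ∈ Γ, α w ∈ Z → β w ∈ W' → α w ∈ W) :
    ∃ f : Z.map W.mkQ →ₗ[k] Z'.map W'.mkQ, Function.Injective f := by
  let K : Submodule k U := Γ ⊓ Z.comap α ⊓ Z'.comap β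
  let f : K →ₗ[k] Z.map W.mkQ :=
    ((W.mkQ ∘ₗ α).domRestrict K).codRestrict _ fun w => ⟨α w, w.2.1.2, rfl⟩
  let g : K →ₗ[k] Z'.map W'.mkQ :=
    ((W'.mkQ ∘ₗ β).domRestrict K).codRestrict _ fun w => ⟨β w, w.2.2, rfl⟩
  have hf : LinearMap.range f = ⊤ := by
    rw [LinearMap.range_eq_top]
    rintro ⟨_, z, hz, rfl⟩
    obtain ⟨w, hw, rfl, hw'⟩ := h₁ z hz
    exact ⟨⟨w, ⟨hw, hz⟩, hw'⟩, rfl⟩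
  obtain ⟨s, hs⟩ := f.exists_rightInverse_of_surjective hf
  refine ⟨g ∘ₗ s, ?_⟩
  rw [injective_iff_map_eq_zero]
  intro x hx
  have hx' : β (s x) ∈ W' := by
    rw [← Submodule.Quotient.mk_eq_zero]
    exact congrArg Subtype.val hx
  have h := h₂ _ (s x).2.1.1 (s x).2.1.2 hx'
  rw [← Submodule.Quotient.mk_eq_zero] at h
  have hsx : f (s x) = x := LinearMap.congr_fun hs x
  rw [← hsx]
  exact Subtype.ext h

lemma relDim_le_of_correspondence {Z W : Submodule k V} {Z' W' : Submodule k V'}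
    [FiniteDimensional k Z'] (Γ : Submodule k U) (α : U →ₗ[k] V) (β : U →ₗ[k] V')
    (h₁ : ∀ z ∈ Z, ∃ w ∈ Γ, α w = z ∧ β w ∈ Z')
    (h₂ : ∀ w ∈ Γ, α w ∈ Z → β w ∈ W' → α w ∈ W) :
    relDim Z W ≤ relDim Z' W' := by
  obtain ⟨f, hf⟩ := exists_injective_of_correspondence Γ α β h₁ h₂
  exact LinearMap.finrank_le_finrank_of_injective hf

lemma relDim_eq_zero_of_le {Z W : Submodule k V} (h : Z ≤ W) : relDim Z W = 0 := by
  have : Z.map W.mkQ = ⊥ := by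
    rw [eq_bot_iff, Submodule.map_le_iff_le_comap, Submodule.comap_bot, Submodule.ker_mkQ]
    exact h
  rw [relDim, this, finrank_bot]

lemma relDim_triangle {Z Y W : Submodule k V} [FiniteDimensional k Z] [FiniteDimensional k Y]
    (hWY : W ≤ Y) : relDim Z W ≤ relDim Z Y + relDim Y W := by
  let q : Z.map W.mkQ →ₗ[k] V ⧸ Y := (W.mapQ Y LinearMap.id hWY).domRestrict _
  rw [relDim, ← LinearMap.finrank_range_add_finrank_ker q]
  gcongr
  · refine Submodule.finrank_mono ?_
    rintro _ ⟨⟨_, z, hz, rfl⟩, rfl⟩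
    exact ⟨z, hz, rfl⟩
  · refine LinearMap.finrank_le_finrank_of_injective
      (f := ((Z.map W.mkQ).subtype ∘ₗ (LinearMap.ker q).subtype).codRestrict (Y.map W.mkQ) ?_) ?_
    · rintro ⟨⟨_, z, hz, rfl⟩, hx⟩
      refine ⟨z, ?_, rfl⟩
      change Y.mkQ z = 0 at hx
      simpa using hx
    · intro x y hxy
      have h : ((x : Z.map W.mkQ) : V ⧸ W) = ((y : Z.map W.mkQ) : V ⧸ W) :=
        congrArg (fun z : Y.map W.mkQ => (z : V ⧸ W)) hxy
      exact Subtype.ext (Subtype.ext h)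

lemma relDim_sup_left (W Y : Submodule k V) : relDim (W ⊔ Y) W = relDim Y W := by
  have h : W.map W.mkQ = ⊥ := by simp
  rw [relDim, relDim, Submodule.map_sup, h, bot_sup_eq]

lemma relDim_anti {Y W W' : Submodule k V} [FiniteDimensional k Y] (h : W' ≤ W) :
    relDim Y W ≤ relDim Y W' :=
  relDim_le_of_correspondence Y LinearMap.id LinearMap.id (fun z hz => ⟨z, hz, rfl, hz⟩)
    fun _ _ _ hw => h hw

lemma finrank_quotient_submoduleOf (Z W : Submodule k V) :
    finrank k (Z ⧸ W.submoduleOf Z) = relDim Z W := by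
  have hk : LinearMap.ker (W.mkQ ∘ₗ Z.subtype) = W.submoduleOf Z := by
    rw [LinearMap.ker_comp, Submodule.ker_mkQ]
    rfl
  have hr : LinearMap.range (W.mkQ ∘ₗ Z.subtype) = Z.map W.mkQ := by
    rw [LinearMap.range_comp, Submodule.range_subtype]
  rw [relDim, ← hr, ← hk]
  exact (LinearMap.quotKerEquivRange _).finrank_eq

lemma relDim_add_finrank {Z W : Submodule k V} [FiniteDimensional k Z] (h : W ≤ Z) :
    relDim Z W + finrank k W = finrank k Z := by
  rw [← finrank_quotient_submoduleOf, ← (Submodule.submoduleOfEquivOfLe h).finrank_eq]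
  exact Submodule.finrank_quotient_add_finrank _

lemma finrank_map_add_finrank_inf_ker (W : Submodule k V) [FiniteDimensional k W]
    (f : V →ₗ[k] V') :
    finrank k (W.map f) + finrank k (W ⊓ LinearMap.ker f : Submodule k V) = finrank k W := by
  rw [← LinearMap.finrank_range_add_finrank_ker (f.domRestrict W),
    LinearMap.range_domRestrict, LinearMap.ker_domRestrict, inf_comm]
  congr 1
  exact ((Submodule.comapSubtypeEquivOfLe (p := LinearMap.ker f ⊓ W) (q := W)
    inf_le_right).symm.trans (LinearEquiv.ofEq _ _ (by ext; simp))).finrank_eq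

/-- Let `c μ` be components indexed by a linear order, of which the elements of `V` have only
finitely many. If each leading (that is, largest nonzero) component of an element of `V` is also
the leading component of an element of `U`, then `dim V ≤ dim U`. -/
lemma finrank_le_of_leading {ι : Type*} [LinearOrder ι] {E E' : Type*} [AddCommGroup E]
    [Module k E] [AddCommGroup E'] [Module k E'] (c : ι → E →ₗ[k] E')
    (V U : Submodule k E) [FiniteDimensional k V] [FiniteDimensional k U]
    (T : Finset ι) (hT : ∀ x ∈ V, ∀ μ ∉ T, c μ x = 0) (hc : ∀ x ∈ V, (∀ μ, c μ x = 0) → x = 0)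
    (hlead : ∀ μ, ∀ x ∈ V, (∀ ν, μ < ν → c ν x = 0) →
      ∃ y ∈ U, (∀ ν, μ < ν → c ν y = 0) ∧ c μ y = c μ x) :
    finrank k V ≤ finrank k U := by
  classical
  induction T using Finset.induction_on_max generalizing V U with
  | empty =>
    have : V = ⊥ := by
      rw [Submodule.eq_bot_iff]
      intro x hx
      exact hc x hx fun μ => hT x hx μ (Finset.notMem_empty μ)
    exact Submodule.finrank_mono (this.trans_le bot_le)
  | insert μ T hμ ih =>
    let V' : Submodule k E := V ⊓ LinearMap.ker (c μ)
    let U₁ : Submodule k E := U ⊓ ⨅ ν : Set.Ioi μ, LinearMap.ker (c ν)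
    let U' : Submodule k E := U₁ ⊓ LinearMap.ker (c μ)
    have hU₁ : ∀ y, y ∈ U₁ ↔ y ∈ U ∧ ∀ ν, μ < ν → c ν y = 0 := by
      intro y
      simp [U₁, Submodule.mem_iInf]
    have : FiniteDimensional k U₁ := Submodule.finiteDimensional_inf_left _ _
    have : FiniteDimensional k V' := Submodule.finiteDimensional_inf_left _ _
    have : FiniteDimensional k U' := Submodule.finiteDimensional_inf_left _ _
    have h₁ : finrank k V' ≤ finrank k U' := by
      refine ih V' U' ?_ (fun x hx => hc x hx.1) ?_
      · intro x hx ν hν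
        by_cases hνμ : ν = μ
        · rw [hνμ]
          exact hx.2
        · exact hT x hx.1 ν (by simp [hνμ, hν])
      · intro ν x hx hxν
        rcases lt_or_ge ν μ with h | h
        · obtain ⟨y, hy, hy₁, hy₂⟩ := hlead ν x hx.1 hxν
          exact ⟨y, ⟨(hU₁ y).2 ⟨hy, fun κ hκ => hy₁ κ (h.trans hκ)⟩, hy₁ μ h⟩, hy₁, hy₂⟩
        · refine ⟨0, zero_mem _, by simp, ?_⟩
          rcases h.eq_or_lt with rfl | h
          · rw [map_zero]
            exact hx.2.symm
          · rw [map_zero, hT x hx.1 ν]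
            rw [Finset.mem_insert, not_or]
            exact ⟨h.ne', fun hν => (hμ ν hν).not_gt h⟩
    have h₂ : V.map (c μ) ≤ U₁.map (c μ) := by
      rintro _ ⟨x, hx, rfl⟩
      obtain ⟨y, hy, hy₁, hy₂⟩ := hlead μ x hx fun ν hν => hT x hx ν (by
        rw [Finset.mem_insert, not_or]
        exact ⟨hν.ne', fun hν' => (hμ ν hν').not_gt hν⟩)
      exact ⟨y, (hU₁ y).2 ⟨hy, hy₁⟩, hy₂⟩
    rw [← finrank_map_add_finrank_inf_ker V (c μ)]
    refine (add_le_add (Submodule.finrank_mono h₂) h₁).trans ?_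
    rw [finrank_map_add_finrank_inf_ker U₁ (c μ)]
    exact Submodule.finrank_mono inf_le_left

end LinearAlgebra

/-! ### The Koszul complex -/

section Koszul

variable {R : Type*} [CommRing R] {ι : Type*} [LinearOrder ι] {N N' : Type*}
  [AddCommGroup N] [AddCommGroup N']

/-- The sign of `e_a` in `e_a ∧ e_A = ± e_{A ∪ a}`. -/
def koszulSign (a : ι) (A : Finset ι) : ℤ := (-1) ^ {b ∈ A | b < a}.card

lemma koszulSign_mul_self (a : ι) (A : Finset ι) : koszulSign a A * koszulSign a A = 1 := by
  rw [koszulSign, ← mul_pow]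
  simp

lemma koszulSign_insert {a b : ι} {A : Finset ι} (ha : a ∉ A) :
    koszulSign b (insert a A) = (if a < b then -1 else 1) * koszulSign b A := by
  rw [koszulSign, koszulSign, Finset.filter_insert]
  split_ifs with h
  · rw [Finset.card_insert_of_notMem (by simp [ha]), pow_succ']
  · rw [one_mul]

lemma koszulSign_swap {a b : ι} {A : Finset ι} (hab : a ≠ b) (ha : a ∉ A) (hb : b ∉ A) :
    koszulSign b (insert a A) * koszulSign a (insert b A) =
      -(koszulSign a A * koszulSign b A) := by
  rw [koszulSign_insert ha, koszulSign_insert hb]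
  rcases lt_or_gt_of_ne hab with h | h <;> simp [h, h.not_gt, mul_comm]

lemma koszulSign_anticomm {a b : ι} {A : Finset ι} (hab : a ≠ b) (ha : a ∉ A) (hb : b ∉ A) :
    koszulSign a A * koszulSign b (insert a A) =
      -(koszulSign b A * koszulSign a (insert b A)) := by
  rw [koszulSign_insert ha, koszulSign_insert hb]
  rcases lt_or_gt_of_ne hab with h | h <;> simp [h, h.not_gt, mul_comm]

variable [Fintype ι] [Module R N]

/-- The differential of the Koszul complex of `x` with coefficients in `N`. A family `f` indexed by
finite sets stands for the element `∑ e_A ⊗ f A` of `⋀ R^ι ⊗ N`. -/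
def koszul (x : ι → R) : (Finset ι → N) →ₗ[R] (Finset ι → N) where
  toFun f A := ∑ a ∈ Aᶜ, koszulSign a A • x a • f (insert a A)
  map_add' f g := by
    ext A
    simp [Finset.sum_add_distrib]
  map_smul' r f := by
    ext A
    simp only [Pi.smul_apply, RingHom.id_apply, Finset.smul_sum]
    refine Finset.sum_congr rfl fun a _ => ?_
    rw [smul_comm (x a) r, smul_comm (koszulSign a A) r]

lemma koszul_apply (x : ι → R) (f : Finset ι → N) (A : Finset ι) :
    koszul x f A = ∑ a ∈ Aᶜ, koszulSign a A • x a • f (insert a A) := rfl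

lemma koszul_koszul (x : ι → R) (f : Finset ι → N) : koszul x (koszul x f) = 0 := by
  ext A
  simp only [koszul_apply, Finset.smul_sum, Pi.zero_apply]
  rw [Finset.sum_sigma']
  refine Finset.sum_involution (fun p _ => ⟨p.2, p.1⟩) ?_ ?_ ?_ ?_
  · rintro ⟨a, b⟩ h
    simp only [Finset.mem_sigma, Finset.mem_compl, Finset.mem_insert, not_or] at h
    obtain ⟨ha, hba, hb⟩ := h
    simp only [smul_comm (x _) (koszulSign _ _), smul_smul, Finset.insert_comm b a]
    rw [koszulSign_anticomm (Ne.symm hba) ha hb, mul_comm (x b), ← add_smul]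
    simp
  · rintro ⟨a, b⟩ h _ h'
    simp only [Finset.mem_sigma, Finset.mem_compl, Finset.mem_insert, not_or] at h
    exact h.2.1 (congrArg Sigma.fst h')
  · rintro ⟨a, b⟩ h
    simp only [Finset.mem_sigma, Finset.mem_compl, Finset.mem_insert, not_or] at h ⊢
    exact ⟨h.2.2, fun h' => h.2.1 h'.symm, h.1⟩
  · rintro ⟨a, b⟩ _
    rfl

/-- Naturality of the Koszul differential, for maps which may depend on the exterior degree. -/
lemma koszul_natural {R' : Type*} [CommRing R'] [Module R' N'] (x : ι → R) (x' : ι → R')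
    (φ : Finset ι → N →+ N')
    (hφ : ∀ A, ∀ a ∉ A, ∀ y, φ A (x a • y) = x' a • φ (insert a A) y) (f : Finset ι → N) :
    koszul x' (fun A => φ A (f A)) = fun A => φ A (koszul x f A) := by
  ext A
  rw [koszul_apply, koszul_apply, map_sum]
  refine Finset.sum_congr rfl fun a ha => ?_
  rw [map_zsmul, hφ A a (Finset.mem_compl.1 ha)]

lemma koszul_map [Module R N'] (x : ι → R) (φ : N →ₗ[R] N') (f : Finset ι → N) :
    koszul x (fun A => φ (f A)) = fun A => φ (koszul x f A) :=
  koszul_natural x x (fun _ => φ.toAddMonoidHom) (fun _ _ _ _ => φ.map_smul _ _) f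

/-- The contracting homotopy `e_a ∧ -`. -/
def wedge (a : ι) (f : Finset ι → N) (A : Finset ι) : N :=
  if a ∈ A then koszulSign a (A.erase a) • f (A.erase a) else 0

lemma koszul_one_wedge (a : ι) (f : Finset ι → N) :
    koszul (1 : ι → R) (wedge a f) + wedge a (koszul (1 : ι → R) f) = f := by
  ext A
  rw [Pi.add_apply, koszul_apply]
  by_cases ha : a ∈ A
  · obtain ⟨A, ha', rfl⟩ : ∃ A', a ∉ A' ∧ A = insert a A' :=
      ⟨A.erase a, Finset.notMem_erase a A, (Finset.insert_erase ha).symm⟩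
    rw [wedge, if_pos ha, Finset.erase_insert ha', koszul_apply, ← Finset.insert_erase
      (Finset.mem_compl.2 ha'), Finset.sum_insert (Finset.notMem_erase _ _), smul_add, smul_smul,
      koszulSign_mul_self, Pi.one_apply, one_smul, one_smul, ← Finset.compl_insert,
      add_left_comm, Finset.smul_sum, ← Finset.sum_add_distrib, Finset.sum_eq_zero, add_zero]
    intro b hb
    simp only [Finset.mem_compl, Finset.mem_insert, not_or] at hb
    rw [wedge, if_pos (by simp), Finset.insert_comm, Finset.erase_insert
      (by simp [ha', Ne.symm hb.1]), Pi.one_apply, one_smul, one_smul, smul_smul, smul_smul,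
      koszulSign_swap (Ne.symm hb.1) ha' hb.2, ← add_smul]
    simp
  · rw [wedge, if_neg ha, add_zero, Finset.sum_eq_single a]
    · rw [wedge, if_pos (Finset.mem_insert_self a A), Finset.erase_insert ha, Pi.one_apply,
        one_smul, smul_smul, koszulSign_mul_self, one_smul]
    · intro b _ hb
      rw [wedge, if_neg (by simp [ha, Ne.symm hb]), smul_zero, smul_zero]
    · intro h
      exact absurd (Finset.mem_compl.2 ha) h

end Koszul

section Multidegree

variable {k : Type u} [Field k] {n : ℕ}

/-- The exponent of the squarefree monomial `∏_{a ∈ A} x_a`. -/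
noncomputable def sqfree (A : Finset (Fin n)) : Fin n →₀ ℕ := ∑ a ∈ A, Finsupp.single a 1

lemma sqfree_insert {a : Fin n} {A : Finset (Fin n)} (ha : a ∉ A) :
    sqfree (insert a A) = Finsupp.single a 1 + sqfree A :=
  Finset.sum_insert ha

lemma sqfree_erase {a : Fin n} {A : Finset (Fin n)} (ha : a ∈ A) :
    sqfree A = Finsupp.single a 1 + sqfree (A.erase a) := by
  rw [← sqfree_insert (Finset.notMem_erase a A), Finset.insert_erase ha]

lemma degree_sqfree (A : Finset (Fin n)) : (sqfree A).degree = A.card := by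
  rw [sqfree, map_sum, Finset.sum_congr rfl fun a _ => Finsupp.degree_single a 1]
  simp

lemma sqfree_apply (A : Finset (Fin n)) (a : Fin n) : sqfree A a = if a ∈ A then 1 else 0 := by
  simp [sqfree, Finsupp.finsetSum_apply, Finsupp.single_apply]

/-- The component of multidegree `μ` of an element `∑ e_A ⊗ f A` of the Koszul complex of `S`:
its coefficients at the basis elements `e_A ⊗ x^{μ - A}`. -/
noncomputable def multiComp (μ : Fin n →₀ ℕ) :
    (Finset (Fin n) → MvPolynomial (Fin n) k) →ₗ[k] (Finset (Fin n) → k) where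
  toFun f A := coeff μ (monomial (sqfree A) 1 * f A)
  map_add' f g := by
    ext A
    simp [mul_add]
  map_smul' r f := by
    ext A
    simp

lemma multiComp_apply (μ : Fin n →₀ ℕ) (f : Finset (Fin n) → MvPolynomial (Fin n) k)
    (A : Finset (Fin n)) :
    multiComp μ f A = if sqfree A ≤ μ then coeff (μ - sqfree A) (f A) else 0 := by
  change coeff μ (monomial (sqfree A) 1 * f A) = _
  rw [coeff_monomial_mul']
  simp

lemma multiComp_add_sqfree (m : Fin n →₀ ℕ) (f : Finset (Fin n) → MvPolynomial (Fin n) k)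
    (A : Finset (Fin n)) : multiComp (m + sqfree A) f A = coeff m (f A) := by
  rw [multiComp_apply, if_pos (by simp), add_tsub_cancel_right]

lemma ext_multiComp {f g : Finset (Fin n) → MvPolynomial (Fin n) k}
    (h : ∀ μ, multiComp μ f = multiComp μ g) : f = g := by
  ext A m
  rw [← multiComp_add_sqfree, h, multiComp_add_sqfree]

lemma multiComp_koszul (μ : Fin n →₀ ℕ) (f : Finset (Fin n) → MvPolynomial (Fin n) k) :
    multiComp μ (koszul (X : Fin n → MvPolynomial (Fin n) k) f) =
      koszul (1 : Fin n → k) (multiComp μ f) := by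
  symm
  refine koszul_natural (N := MvPolynomial (Fin n) k) X (1 : Fin n → k)
    (fun A => (lcoeff k μ).toAddMonoidHom.comp
      (AddMonoidHom.mulLeft (monomial (sqfree A) (1 : k)))) ?_ f
  intro A a ha y
  change coeff μ (monomial (sqfree A) 1 * (X a * y)) =
    1 * coeff μ (monomial (sqfree (insert a A)) 1 * y)
  rw [one_mul, sqfree_insert ha, ← mul_assoc, X, monomial_mul, add_comm, one_mul]

/-- The element of multidegree `μ` of the Koszul complex of `S` with the given coefficients. -/
noncomputable def multiEmbed (μ : Fin n →₀ ℕ) (g : Finset (Fin n) → k) :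
    Finset (Fin n) → MvPolynomial (Fin n) k :=
  fun A => if sqfree A ≤ μ then monomial (μ - sqfree A) (g A) else 0

lemma multiComp_multiEmbed (ν μ : Fin n →₀ ℕ) (g : Finset (Fin n) → k)
    (hg : ∀ A, g A ≠ 0 → sqfree A ≤ μ) :
    multiComp ν (multiEmbed μ g) = if ν = μ then g else 0 := by
  ext A
  change coeff ν (monomial (sqfree A) 1 * multiEmbed μ g A) = _
  rw [multiEmbed]
  by_cases h : sqfree A ≤ μ
  · rw [if_pos h, monomial_mul, add_tsub_cancel_of_le h, coeff_monomial, one_mul]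
    by_cases hν : ν = μ
    · rw [if_pos hν.symm, if_pos hν]
    · rw [if_neg (Ne.symm hν), if_neg hν, Pi.zero_apply]
  · have : g A = 0 := by
      by_contra h'
      exact h (hg A h')
    rw [if_neg h, mul_zero, coeff_zero]
    split_ifs <;> simp [this]

lemma sqfree_le_of_multiComp_ne_zero {μ : Fin n →₀ ℕ}
    {f : Finset (Fin n) → MvPolynomial (Fin n) k} {A : Finset (Fin n)}
    (h : multiComp μ f A ≠ 0) : sqfree A ≤ μ := by
  by_contra h'
  exact h (by rw [multiComp_apply, if_neg h'])

/-- A finite set which contains all the multidegrees that occur in `f`. -/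
lemma exists_multidegrees (f : Finset (Fin n) → MvPolynomial (Fin n) k) :
    ∃ T : Finset (Fin n →₀ ℕ), ∀ μ ∉ T, multiComp μ f = 0 := by
  classical
  refine ⟨Finset.univ.biUnion fun A => (f A).support.image (· + sqfree A), fun μ hμ => ?_⟩
  ext A
  by_contra h
  have hle := sqfree_le_of_multiComp_ne_zero h
  refine hμ (Finset.mem_biUnion.2 ⟨A, Finset.mem_univ A, Finset.mem_image.2
    ⟨μ - sqfree A, ?_, tsub_add_cancel_of_le hle⟩⟩)
  rw [mem_support_iff]
  rwa [multiComp_apply, if_pos hle] at h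

/-- The Koszul complex of `S` is exact in each nonzero multidegree `μ`: if `x_a` divides `x^μ`,
then `e_a ∧ -` is a contracting homotopy there. -/
lemma exists_koszul_eq {z : Finset (Fin n) → MvPolynomial (Fin n) k}
    (hz : koszul (X : Fin n → MvPolynomial (Fin n) k) z = 0)
    (hz₀ : coeff 0 (z ∅) = 0) :
    ∃ w : Finset (Fin n) → MvPolynomial (Fin n) k,
      koszul (X : Fin n → MvPolynomial (Fin n) k) w = z ∧
      ∀ A m, coeff m (w A) ≠ 0 →
        ∃ a ∈ A, coeff (m + Finsupp.single a 1) (z (A.erase a)) ≠ 0 := by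
  classical
  have hz₀' : multiComp 0 z = 0 := by
    ext A
    rw [multiComp_apply]
    split_ifs with h
    · have : A = ∅ := by
        rw [← Finset.card_eq_zero, ← degree_sqfree, nonpos_iff_eq_zero.1 h]
        simp
      subst this
      simpa using hz₀
    · rfl
  have ha : ∀ μ : Fin n →₀ ℕ, ∃ g : Finset (Fin n) → k,
      koszul (1 : Fin n → k) g = multiComp μ z ∧ ∀ A, g A ≠ 0 →
        sqfree A ≤ μ ∧ ∃ a ∈ A, multiComp μ z (A.erase a) ≠ 0 := by
    intro μ
    by_cases hμ : μ = 0
    · exact ⟨0, by rw [hμ, hz₀', map_zero], fun A h => absurd rfl h⟩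
    · obtain ⟨a, ha⟩ := Finsupp.ne_iff.1 hμ
      refine ⟨wedge a (multiComp μ z), ?_, fun A hA => ?_⟩
      · have h := koszul_one_wedge (R := k) a (multiComp μ z)
        rw [← multiComp_koszul, hz, map_zero] at h
        convert h using 1
        rw [left_eq_add]
        ext A
        simp [wedge]
      · rw [wedge] at hA
        split_ifs at hA with haA
        · have h : multiComp μ z (A.erase a) ≠ 0 := fun h0 => hA (by rw [h0, smul_zero])
          refine ⟨?_, a, haA, h⟩
          have hle := sqfree_le_of_multiComp_ne_zero h
          intro b
          have hb := hle b
          rw [sqfree_apply] at hb ⊢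
          by_cases hba : b = a
          · subst hba
            rw [if_pos haA]
            exact Nat.one_le_iff_ne_zero.2 ha
          · simpa [hba] using hb
        · exact absurd rfl hA
  choose g hg hg' using ha
  obtain ⟨T, hT⟩ := exists_multidegrees z
  have hw : ∀ ν, multiComp ν (∑ μ ∈ T, multiEmbed μ (g μ)) = if ν ∈ T then g ν else 0 := by
    intro ν
    rw [map_sum, Finset.sum_congr rfl fun μ _ =>
      multiComp_multiEmbed ν μ (g μ) fun A hA => (hg' μ A hA).1, Finset.sum_ite_eq]
  refine ⟨∑ μ ∈ T, multiEmbed μ (g μ), ?_, ?_⟩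
  · refine ext_multiComp fun ν => ?_
    rw [multiComp_koszul, hw]
    split_ifs with h
    · exact hg ν
    · rw [map_zero, hT ν h]
  · intro A m hm
    rw [← multiComp_add_sqfree, hw] at hm
    split_ifs at hm with h
    · obtain ⟨-, a, ha, haz⟩ := hg' _ A hm
      refine ⟨a, ha, ?_⟩
      rwa [sqfree_erase ha, ← add_assoc, multiComp_add_sqfree] at haz
    · exact absurd rfl hm

end Multidegree

/-! ### Graded Koszul homology -/

section Graded

variable {k : Type u} [Field k] {n : ℕ} {N : Type*} [AddCommGroup N] [Module k N]

/-- The part of homological degree `p` and internal degree `t` of the Koszul complex of a graded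
module, which is given by its homogeneous components `𝓜 e`. As `e_A` has degree `|A|`, the
coefficients there are in `𝓜 (t - p)`. -/
def koszulPiece (𝓜 : ℕ → Submodule k N) (p t : ℕ) : Submodule k (Finset (Fin n) → N) :=
  Submodule.pi Set.univ fun A => if A.card = p ∧ p ≤ t then 𝓜 (t - p) else ⊥

lemma mem_koszulPiece {𝓜 : ℕ → Submodule k N} {p t : ℕ} {f : Finset (Fin n) → N} :
    f ∈ koszulPiece 𝓜 p t ↔ ∀ A, f A ≠ 0 → ∃ e, A.card = p ∧ p + e = t ∧ f A ∈ 𝓜 e := by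
  rw [koszulPiece, Submodule.mem_pi]
  refine forall_congr' fun A => ?_
  constructor
  · intro h hA
    have h := h (Set.mem_univ A)
    split_ifs at h with hc
    · exact ⟨t - p, hc.1, by omega, h⟩
    · exact absurd h hA
  · intro h _
    by_cases hA : f A = 0
    · rw [hA]
      exact zero_mem _
    · obtain ⟨e, hc, rfl, he⟩ := h hA
      rw [if_pos ⟨hc, by omega⟩, Nat.add_sub_cancel_left]
      exact he

lemma koszulPiece_mono {𝓜 𝓜' : ℕ → Submodule k N} {p t : ℕ}
    (h : ∀ e, p + e = t → 𝓜 e ≤ 𝓜' e) :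
    koszulPiece (n := n) 𝓜 p t ≤ koszulPiece 𝓜' p t := by
  intro f hf
  rw [mem_koszulPiece] at hf ⊢
  intro A hA
  obtain ⟨e, hc, he, h'⟩ := hf A hA
  exact ⟨e, hc, he, h e he h'⟩

variable [Module (MvPolynomial (Fin n) k) N] [IsScalarTower k (MvPolynomial (Fin n) k) N]

/-- The Koszul differential of `x₁, …, xₙ`, as a `k`-linear map. -/
noncomputable def koszulX : (Finset (Fin n) → N) →ₗ[k] (Finset (Fin n) → N) :=
  (koszul (X : Fin n → MvPolynomial (Fin n) k)).restrictScalars k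

lemma koszulX_apply (f : Finset (Fin n) → N) :
    koszulX (k := k) f = koszul (X : Fin n → MvPolynomial (Fin n) k) f := rfl

lemma koszulX_koszulX (f : Finset (Fin n) → N) : koszulX (k := k) (koszulX (k := k) f) = 0 :=
  koszul_koszul _ f

lemma koszulX_smul (s : MvPolynomial (Fin n) k) (f : Finset (Fin n) → N) :
    koszulX (k := k) (s • f) = s • koszulX (k := k) f :=
  (koszul (X : Fin n → MvPolynomial (Fin n) k)).map_smul s f

lemma koszulX_mem_koszulPiece {𝓜 : ℕ → Submodule k N}
    (h𝓜 : ∀ e (a : Fin n), ∀ x ∈ 𝓜 e, (X a : MvPolynomial (Fin n) k) • x ∈ 𝓜 (e + 1))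
    {p t : ℕ} {f : Finset (Fin n) → N} (hf : f ∈ koszulPiece 𝓜 (p + 1) t) :
    koszulX (k := k) f ∈ koszulPiece 𝓜 p t := by
  rw [mem_koszulPiece] at hf ⊢
  intro A hA
  rw [koszulX_apply, koszul_apply] at hA ⊢
  obtain ⟨a, ha, haA⟩ := Finset.exists_ne_zero_of_sum_ne_zero hA
  rw [Finset.mem_compl] at ha
  obtain ⟨e, hc, he, -⟩ := hf (insert a A) fun h => haA (by rw [h, smul_zero, smul_zero])
  rw [Finset.card_insert_of_notMem ha] at hc
  refine ⟨e + 1, by omega, by omega, Submodule.sum_mem _ fun b _ => zsmul_mem (h𝓜 e b _ ?_) _⟩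
  by_cases h0 : f (insert b A) = 0
  · rw [h0]
    exact zero_mem _
  · obtain ⟨e', -, he', h⟩ := hf _ h0
    have : e' = e := by omega
    rwa [← this]

/-- The Koszul cycles of homological degree `p` and internal degree `t`. -/
noncomputable def koszulCycles (𝓜 : ℕ → Submodule k N) (p t : ℕ) :
    Submodule k (Finset (Fin n) → N) :=
  koszulPiece 𝓜 p t ⊓ LinearMap.ker koszulX

/-- The Koszul boundaries of homological degree `p` and internal degree `t`. -/
noncomputable def koszulBoundaries (𝓜 : ℕ → Submodule k N) (p t : ℕ) :
    Submodule k (Finset (Fin n) → N) :=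
  (koszulPiece 𝓜 (p + 1) t).map koszulX

lemma koszulBoundaries_le_koszulCycles {𝓜 : ℕ → Submodule k N}
    (h𝓜 : ∀ e (a : Fin n), ∀ x ∈ 𝓜 e, (X a : MvPolynomial (Fin n) k) • x ∈ 𝓜 (e + 1))
    (p t : ℕ) : koszulBoundaries (n := n) 𝓜 p t ≤ koszulCycles 𝓜 p t := by
  rintro _ ⟨f, hf, rfl⟩
  exact ⟨koszulX_mem_koszulPiece h𝓜 hf, koszulX_koszulX f⟩

/-- The dimension of the Koszul homology of homological degree `p` and internal degree `t`. -/
noncomputable def koszulDim (n : ℕ) [Module (MvPolynomial (Fin n) k) N]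
    [IsScalarTower k (MvPolynomial (Fin n) k) N] (𝓜 : ℕ → Submodule k N) (p t : ℕ) : ℕ :=
  relDim (koszulCycles (n := n) 𝓜 p t) (koszulBoundaries (n := n) 𝓜 p t)

lemma koszulCycles_zero (𝓜 : ℕ → Submodule k N) (t : ℕ) :
    koszulCycles (n := n) 𝓜 0 t = koszulPiece 𝓜 0 t := by
  refine inf_eq_left.2 fun f hf => ?_
  rw [LinearMap.mem_ker]
  ext A
  refine Finset.sum_eq_zero fun a _ => ?_
  by_cases h0 : f (insert a A) = 0
  · rw [h0, smul_zero, smul_zero]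
  · obtain ⟨e, hc, -⟩ := mem_koszulPiece.1 hf _ h0
    rw [Finset.card_eq_zero] at hc
    exact absurd hc (Finset.insert_ne_empty a A)

lemma finiteDimensional_koszulPiece {𝓜 : ℕ → Submodule k (MvPolynomial (Fin n) k)}
    (h𝓜 : ∀ e, 𝓜 e ≤ homogeneousSubmodule (Fin n) k e) (p t : ℕ) :
    FiniteDimensional k (koszulPiece (n := n) 𝓜 p t) := by
  have : Module.Finite k (homogeneousSubmodule (Fin n) k (t - p)) :=
    Module.Finite.of_fg (homogeneousSubmodule_fg (Fin n) k (t - p))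
  have hmem : ∀ f ∈ koszulPiece (n := n) 𝓜 p t, ∀ A,
      f A ∈ homogeneousSubmodule (Fin n) k (t - p) := by
    intro f hf A
    by_cases h0 : f A = 0
    · rw [h0]
      exact zero_mem _
    · obtain ⟨e, -, he, h⟩ := mem_koszulPiece.1 hf A h0
      have : e = t - p := by omega
      rw [← this]
      exact h𝓜 e h
  let φ : koszulPiece (n := n) 𝓜 p t →ₗ[k]
      (Finset (Fin n) → homogeneousSubmodule (Fin n) k (t - p)) :=
    LinearMap.pi fun A => (LinearMap.proj A ∘ₗ (koszulPiece (n := n) 𝓜 p t).subtype).codRestrict _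
      fun f => hmem f f.2 A
  refine Module.Finite.of_injective φ fun f g hfg => ?_
  ext1
  funext A
  exact congrArg Subtype.val (congrFun hfg A)

end Graded

/-! ### Koszul homology of monomial ideals -/

section Monomial

variable {k : Type u} [Field k] {n : ℕ}

/-- The forms of degree `e` in the span of the monomials with exponents in `D`. -/
noncomputable def monoPiece (k : Type u) [Field k] (D : Set (Fin n →₀ ℕ)) (e : ℕ) :
    Submodule k (MvPolynomial (Fin n) k) where
  carrier := {p | ∀ m, coeff m p ≠ 0 → m ∈ D ∧ m.degree = e}
  zero_mem' m h := absurd (coeff_zero m) h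
  add_mem' := by
    intro p q hp hq m h
    by_cases h0 : coeff m p = 0
    · exact hq m fun h1 => h (by rw [coeff_add, h0, h1, add_zero])
    · exact hp m h0
  smul_mem' := by
    intro c p hp m h
    exact hp m fun h0 => h (by rw [coeff_smul, h0, smul_zero])

lemma monoPiece_le (D : Set (Fin n →₀ ℕ)) (e : ℕ) :
    monoPiece k D e ≤ homogeneousSubmodule (Fin n) k e := by
  intro p hp m hm
  have h := (hp m hm).2
  rw [Finsupp.degree_eq_weight_one] at h
  exact h

lemma X_smul_mem_monoPiece {D : Set (Fin n →₀ ℕ)} (hD : IsUpperSet D) (e : ℕ) (a : Fin n)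
    (p : MvPolynomial (Fin n) k) (hp : p ∈ monoPiece k D e) :
    (X a : MvPolynomial (Fin n) k) • p ∈ monoPiece k D (e + 1) := by
  intro m hm
  rw [smul_eq_mul, coeff_X_mul'] at hm
  split_ifs at hm with ha
  · obtain ⟨h₁, h₂⟩ := hp _ hm
    have hle : Finsupp.single a 1 ≤ m := by
      rw [Finsupp.single_le_iff]
      exact Nat.one_le_iff_ne_zero.2 (Finsupp.mem_support_iff.1 ha)
    refine ⟨hD tsub_le_self h₁, ?_⟩
    rw [← tsub_add_cancel_of_le hle, map_add, h₂, Finsupp.degree_single]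
  · exact absurd rfl hm

lemma mem_koszulPiece_monoPiece {D : Set (Fin n →₀ ℕ)} {p t : ℕ}
    {f : Finset (Fin n) → MvPolynomial (Fin n) k} :
    f ∈ koszulPiece (monoPiece k D) p t ↔
      ∀ A m, coeff m (f A) ≠ 0 → A.card = p ∧ p + m.degree = t ∧ m ∈ D := by
  rw [mem_koszulPiece]
  refine forall_congr' fun A => ?_
  constructor
  · intro h m hm
    obtain ⟨e, hc, he, h⟩ := h fun h0 => hm (by rw [h0, coeff_zero])
    obtain ⟨h₁, rfl⟩ := h m hm
    exact ⟨hc, he, h₁⟩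
  · intro h hA
    obtain ⟨m, hm⟩ := MvPolynomial.ne_zero_iff.1 hA
    obtain ⟨hc, he, -⟩ := h m hm
    refine ⟨m.degree, hc, he, fun m' hm' => ?_⟩
    obtain ⟨-, he', h'⟩ := h m' hm'
    exact ⟨h', by omega⟩

instance (D : Set (Fin n →₀ ℕ)) (p t : ℕ) :
    FiniteDimensional k (koszulPiece (n := n) (monoPiece k D) p t) :=
  finiteDimensional_koszulPiece (monoPiece_le D) p t

instance (D : Set (Fin n →₀ ℕ)) (p t : ℕ) :
    FiniteDimensional k (koszulCycles (n := n) (monoPiece k D) p t) :=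
  Submodule.finiteDimensional_inf_left _ _

instance (D : Set (Fin n →₀ ℕ)) (p t : ℕ) :
    FiniteDimensional k (koszulBoundaries (n := n) (monoPiece k D) p t) :=
  inferInstanceAs (FiniteDimensional k ((koszulPiece (monoPiece k D) (p + 1) t).map koszulX))

/-- Acyclicity of the Koszul complex of `S`, degree by degree. -/
lemma exists_koszulX_eq {p t : ℕ} {z : Finset (Fin n) → MvPolynomial (Fin n) k}
    (hz : z ∈ koszulPiece (monoPiece k Set.univ) p t) (hz₀ : koszulX (k := k) z = 0)
    (hz₁ : coeff 0 (z ∅) = 0) :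
    ∃ y ∈ koszulPiece (monoPiece k Set.univ) (p + 1) t, koszulX (k := k) y = z := by
  obtain ⟨y, hy, hyz⟩ := exists_koszul_eq hz₀ hz₁
  refine ⟨y, mem_koszulPiece_monoPiece.2 fun A m hm => ?_, hy⟩
  obtain ⟨a, ha, haz⟩ := hyz A m hm
  obtain ⟨hc, he, -⟩ := mem_koszulPiece_monoPiece.1 hz _ _ haz
  rw [Finset.card_erase_of_mem ha] at hc
  have := Finset.card_pos.2 ⟨a, ha⟩
  rw [map_add, Finsupp.degree_single] at he
  exact ⟨by omega, by omega, Set.mem_univ m⟩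

/-- The part of a polynomial which is supported on a set of exponents. -/
lemma exists_coeff_eq_ite (D : Set (Fin n →₀ ℕ)) [DecidablePred (· ∈ D)]
    (p : MvPolynomial (Fin n) k) :
    ∃ q : MvPolynomial (Fin n) k, ∀ m, coeff m q = if m ∈ D then coeff m p else 0 := by
  classical
  refine ⟨∑ m ∈ p.support with m ∈ D, monomial m (coeff m p), fun m => ?_⟩
  rw [coeff_sum]
  simp only [coeff_monomial, Finset.sum_ite_eq', Finset.mem_filter, mem_support_iff]
  by_cases h : m ∈ D <;> by_cases h' : coeff m p = 0 <;> simp [h, h']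

lemma exists_eq_add_monomial_smul {D : Set (Fin n →₀ ℕ)} {m : Fin n →₀ ℕ} {p t : ℕ}
    {z : Finset (Fin n) → MvPolynomial (Fin n) k}
    (hz : z ∈ koszulPiece (monoPiece k (D ∪ Set.Ici m)) p t) :
    ∃ z' ∈ koszulPiece (monoPiece k D) p t, ∃ w : Finset (Fin n) → MvPolynomial (Fin n) k,
      z = z' + monomial m (1 : k) • w ∧
        ∀ A q, coeff q (w A) ≠ 0 → A.card = p ∧ p + q.degree + m.degree = t := by
  classical
  rw [mem_koszulPiece_monoPiece] at hz
  choose z' hz' using fun A => exists_coeff_eq_ite D (z A)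
  refine ⟨z', mem_koszulPiece_monoPiece.2 fun A q hq => ?_,
    fun A => (z A - z' A).divMonomial m, ?_, fun A q hq => ?_⟩
  · rw [hz'] at hq
    split_ifs at hq with h
    · exact ⟨(hz A q hq).1, (hz A q hq).2.1, h⟩
    · exact absurd rfl hq
  · ext A q
    rw [Pi.add_apply, coeff_add, Pi.smul_apply, smul_eq_mul, coeff_monomial_mul',
      coeff_divMonomial, coeff_sub, hz']
    by_cases hD : q ∈ D
    · split_ifs with h
      · rw [add_tsub_cancel_of_le h, hz', if_pos hD]
        ring
      · ring
    · split_ifs with h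
      · rw [add_tsub_cancel_of_le h, hz', if_neg hD]
        ring
      · by_contra h0
        rw [add_zero] at h0
        exact (hz A q h0).2.2.elim hD h
  · rw [coeff_divMonomial, coeff_sub, hz'] at hq
    have h0 : coeff (m + q) (z A) ≠ 0 := by
      intro h0
      rw [h0] at hq
      simp at hq
    obtain ⟨hc, he, -⟩ := hz A _ h0
    rw [map_add] at he
    exact ⟨hc, by omega⟩

lemma monomial_smul_mem {D : Set (Fin n →₀ ℕ)} {m : Fin n →₀ ℕ} {p s : ℕ}
    {w : Finset (Fin n) → MvPolynomial (Fin n) k}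
    (hw : w ∈ koszulPiece (monoPiece k {q | q + m ∈ D}) p s) :
    monomial m (1 : k) • w ∈ koszulPiece (monoPiece k D) p (s + m.degree) := by
  rw [mem_koszulPiece_monoPiece] at hw ⊢
  intro A q hq
  rw [Pi.smul_apply, smul_eq_mul, coeff_monomial_mul'] at hq
  split_ifs at hq with h
  · rw [one_mul] at hq
    obtain ⟨hc, he, hD⟩ := hw A _ hq
    have hdeg : (q - m).degree + m.degree = q.degree := by
      rw [← map_add, tsub_add_cancel_of_le h]
    refine ⟨hc, by omega, ?_⟩
    rwa [Set.mem_ofPred_eq, tsub_add_cancel_of_le h] at hD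
  · exact absurd rfl hq

lemma koszulPiece_monoPiece_mono {D D' : Set (Fin n →₀ ℕ)} (h : D' ⊆ D) (p t : ℕ) :
    koszulPiece (n := n) (monoPiece k D') p t ≤ koszulPiece (monoPiece k D) p t :=
  koszulPiece_mono fun _ _ _ hq m hm => ⟨h (hq m hm).1, (hq m hm).2⟩

/-- Homology of the ideal of `D` is made up of classes of cycles of the smaller ideal of `D'`, of
which there are at most as many as in the homology of that ideal, and of what remains. -/
lemma koszulDim_le_add {D D' : Set (Fin n →₀ ℕ)} (h : D' ⊆ D) (p t : ℕ) :
    koszulDim n (monoPiece k D) p t ≤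
      relDim (koszulCycles (n := n) (monoPiece k D) p t)
        (koszulBoundaries (monoPiece k D) p t ⊔ koszulCycles (monoPiece k D') p t) +
      koszulDim n (monoPiece k D') p t := by
  refine (relDim_triangle le_sup_left).trans (Nat.add_le_add_left ?_ _)
  rw [relDim_sup_left]
  exact relDim_anti (Submodule.map_mono (koszulPiece_monoPiece_mono h _ _))

/-- Exactness of the Mayer-Vietoris sequence: if the image `∂w` of the cycle `z' + x^m w` under the
connecting map is a boundary `∂v` of the colon ideal `(D : x^m)`, then the acyclicity of the Koszul
complex of `S`, applied to `w - v`, shows that the cycle comes from `D` up to a boundary. -/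
lemma add_monomial_smul_mem {D : Set (Fin n →₀ ℕ)} {m : Fin n →₀ ℕ} {p s : ℕ}
    {z' w v : Finset (Fin n) → MvPolynomial (Fin n) k}
    (hz' : z' ∈ koszulPiece (monoPiece k D) p (s + m.degree))
    (hw : w ∈ koszulPiece (monoPiece k Set.univ) p s)
    (hv : v ∈ koszulPiece (monoPiece k {q | q + m ∈ D}) p s)
    (hz : koszulX (k := k) (z' + monomial m (1 : k) • w) = 0)
    (hwv : koszulX (k := k) w = koszulX (k := k) v)
    (h0 : coeff 0 ((w - v) ∅) = 0) :
    z' + monomial m (1 : k) • w ∈ koszulBoundaries (monoPiece k (D ∪ Set.Ici m)) p (s + m.degree) ⊔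
      koszulCycles (monoPiece k D) p (s + m.degree) := by
  obtain ⟨y, hy, hyw⟩ := exists_koszulX_eq
    (sub_mem hw (koszulPiece_monoPiece_mono (Set.subset_univ _) _ _ hv))
    (by rw [map_sub, hwv, sub_self]) h0
  refine Submodule.mem_sup.2 ⟨koszulX (k := k) (monomial m (1 : k) • y), ⟨_, ?_, rfl⟩,
    z' + monomial m (1 : k) • v, ⟨add_mem hz' (monomial_smul_mem hv), ?_⟩, ?_⟩
  · refine monomial_smul_mem (koszulPiece_monoPiece_mono (fun q _ => ?_) _ _ hy)
    exact Or.inr (self_le_add_left m q)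
  · change koszulX (k := k) _ = 0
    rw [← hz, map_add, map_add, koszulX_smul, koszulX_smul, hwv]
  · rw [koszulX_smul, hyw, smul_sub]
    abel

lemma koszulDim_zero_union_Ici_le (D : Set (Fin n →₀ ℕ)) (m : Fin n →₀ ℕ) (t : ℕ) :
    koszulDim n (monoPiece k (D ∪ Set.Ici m)) 0 t ≤
      koszulDim n (monoPiece k D) 0 t + if t = m.degree then 1 else 0 := by
  refine (koszulDim_le_add Set.subset_union_left 0 t).trans ?_
  rw [add_comm]
  refine Nat.add_le_add_left ?_ _
  by_cases ht : m.degree ≤ t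
  · obtain ⟨s, rfl⟩ := Nat.exists_eq_add_of_le' ht
    let Z' : Submodule k k := if s = 0 then ⊤ else ⊥
    have hZ' : relDim Z' ⊥ ≤ if s + m.degree = m.degree then 1 else 0 := by
      by_cases hs : s = 0
      · rw [if_pos (by omega)]
        refine (Submodule.finrank_map_le _ _).trans ?_
        exact (Submodule.finrank_le _).trans (Module.finrank_self k).le
      · rw [if_neg (by omega), nonpos_iff_eq_zero]
        refine relDim_eq_zero_of_le ?_
        simp [Z', hs]
    refine le_trans ?_ hZ'
    refine relDim_le_of_correspondence
      ((koszulPiece (monoPiece k D) 0 (s + m.degree)).prod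
        (koszulPiece (monoPiece k Set.univ) 0 s))
      (LinearMap.coprod LinearMap.id (LinearMap.lsmul (MvPolynomial (Fin n) k)
        (Finset (Fin n) → MvPolynomial (Fin n) k) (monomial m 1) |>.restrictScalars k))
      (lcoeff k 0 ∘ₗ LinearMap.proj ∅ ∘ₗ LinearMap.snd k _ _) ?_ ?_
    · intro z hz
      obtain ⟨z', hz', w, rfl, hw⟩ := exists_eq_add_monomial_smul hz.1
      refine ⟨(z', w), ⟨hz', ?_⟩, rfl, ?_⟩
      · exact mem_koszulPiece_monoPiece.2 fun A q hq =>
          ⟨(hw A q hq).1, by have := (hw A q hq).2; omega, Set.mem_univ q⟩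
      · change coeff 0 (w ∅) ∈ Z'
        by_cases hs : s = 0
        · simp [Z', hs]
        · have : coeff 0 (w ∅) = 0 := by
            by_contra h0
            have := (hw ∅ 0 h0).2
            simp at this
            omega
          rw [this]
          exact zero_mem _
    · rintro ⟨z', w⟩ ⟨hz', hw⟩ hz h0
      refine add_monomial_smul_mem hz' hw (zero_mem _) hz.2 ?_ ?_
      · have h := (koszulCycles_zero (monoPiece k (Set.univ : Set (Fin n →₀ ℕ))) s).ge hw
        rw [map_zero]
        exact h.2
      · simpa using h0
  · rw [relDim_eq_zero_of_le]
    · exact Nat.zero_le _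
    · intro z hz
      obtain ⟨z', hz', w, rfl, hw⟩ := exists_eq_add_monomial_smul hz.1
      have hw0 : w = 0 := by
        ext A q
        by_contra h0
        have := (hw A q h0).2
        omega
      subst hw0
      rw [smul_zero, add_zero] at hz ⊢
      exact Submodule.mem_sup_right ⟨hz', hz.2⟩

/-- For `i > 0`, the part of the homology of the ideal `J` generated by `D` and `x^m` which does
not come from `D` embeds into the homology of the colon ideal `(D : x^m)`, by the connecting map of
`0 → (D : x^m)(-|m|) → (D) ⊕ S(-|m|) → J → 0`. -/
lemma koszulDim_succ_union_Ici_le {D : Set (Fin n →₀ ℕ)} (hD : IsUpperSet D) (m : Fin n →₀ ℕ)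
    (i t : ℕ) :
    koszulDim n (monoPiece k (D ∪ Set.Ici m)) (i + 1) t ≤
      koszulDim n (monoPiece k D) (i + 1) t +
        if m.degree ≤ t then koszulDim n (monoPiece k {q | q + m ∈ D}) i (t - m.degree)
        else 0 := by
  refine (koszulDim_le_add Set.subset_union_left (i + 1) t).trans ?_
  rw [add_comm]
  refine Nat.add_le_add_left ?_ _
  split_ifs with ht
  · obtain ⟨s, rfl⟩ := Nat.exists_eq_add_of_le' ht
    rw [Nat.add_sub_cancel]
    refine relDim_le_of_correspondence
      ((koszulPiece (monoPiece k D) (i + 1) (s + m.degree)).prod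
        (koszulPiece (monoPiece k Set.univ) (i + 1) s))
      (LinearMap.coprod LinearMap.id (LinearMap.lsmul (MvPolynomial (Fin n) k)
        (Finset (Fin n) → MvPolynomial (Fin n) k) (monomial m 1) |>.restrictScalars k))
      (koszulX ∘ₗ LinearMap.snd k _ _) ?_ ?_
    · intro z hz
      obtain ⟨z', hz', w, rfl, hw⟩ := exists_eq_add_monomial_smul hz.1
      have hw' : w ∈ koszulPiece (monoPiece k Set.univ) (i + 1) s :=
        mem_koszulPiece_monoPiece.2 fun A q hq =>
          ⟨(hw A q hq).1, by have := (hw A q hq).2; omega, Set.mem_univ q⟩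
      refine ⟨(z', w), ⟨hz', hw'⟩, rfl, ?_, koszulX_koszulX w⟩
      have h₁ := mem_koszulPiece_monoPiece.1
        (koszulX_mem_koszulPiece (X_smul_mem_monoPiece isUpperSet_univ) hw')
      have h₂ := mem_koszulPiece_monoPiece.1
        (koszulX_mem_koszulPiece (X_smul_mem_monoPiece hD) hz')
      refine mem_koszulPiece_monoPiece.2 fun A q hq => ⟨(h₁ A q hq).1, (h₁ A q hq).2.1, ?_⟩
      have h₃ : koszulX (k := k) z' + monomial m (1 : k) • koszulX (k := k) w = 0 := by
        rw [← koszulX_smul, ← map_add]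
        exact hz.2
      refine (h₂ A (q + m) ?_).2.2
      intro h0
      have h₄ := congrArg (coeff (q + m)) (congrFun h₃ A)
      rw [Pi.add_apply, coeff_add, h0, Pi.smul_apply, smul_eq_mul, add_comm q m,
        coeff_monomial_mul] at h₄
      refine hq ?_
      simpa using h₄
    · rintro ⟨z', w⟩ ⟨hz', hw⟩ hz ⟨v, hv, hvw⟩
      refine add_monomial_smul_mem hz' hw hv hz.2 hvw.symm ?_
      by_contra h0
      have := (mem_koszulPiece_monoPiece.1
        (sub_mem hw (koszulPiece_monoPiece_mono (Set.subset_univ _) _ _ hv)) ∅ 0 h0).1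
      simp at this
  · rw [relDim_eq_zero_of_le]
    intro z hz
    obtain ⟨z', hz', w, rfl, hw⟩ := exists_eq_add_monomial_smul hz.1
    have hw0 : w = 0 := by
      ext A q
      by_contra h0
      have := (hw A q h0).2
      omega
    subst hw0
    rw [smul_zero, add_zero] at hz ⊢
    exact Submodule.mem_sup_right ⟨hz', hz.2⟩

/-- The exponents of the multiples of the monomials with exponents in `G`. -/
def multiples (G : Finset (Fin n →₀ ℕ)) : Set (Fin n →₀ ℕ) := {m | ∃ g ∈ G, g ≤ m}

lemma isUpperSet_multiples (G : Finset (Fin n →₀ ℕ)) : IsUpperSet (multiples G) := by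
  rintro a b hab ⟨g, hg, h⟩
  exact ⟨g, hg, h.trans hab⟩

lemma koszulDim_empty (p t : ℕ) : koszulDim n (monoPiece k (∅ : Set (Fin n →₀ ℕ))) p t = 0 := by
  refine relDim_eq_zero_of_le fun z hz => ?_
  have : z = 0 := by
    ext A q
    by_contra h0
    exact (mem_koszulPiece_monoPiece.1 hz.1 A q h0).2.2
  rw [this]
  exact zero_mem _

/-- The Taylor bound: the `i`-th total Betti number of an ideal with `N` monomial generators is at
most `N.choose (i + 1)`. By induction on the number of generators, `(D : x^m)` being generated by
at most as many monomials as `D`. -/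
lemma sum_koszulDim_multiples_le (N : ℕ) (G : Finset (Fin n →₀ ℕ)) (hG : G.card ≤ N) (i : ℕ)
    (T : Finset ℕ) :
    ∑ t ∈ T, koszulDim n (monoPiece k (multiples G)) i t ≤ N.choose (i + 1) := by
  classical
  induction N generalizing G i T with
  | zero =>
    have : multiples G = ∅ := by
      rw [nonpos_iff_eq_zero, Finset.card_eq_zero] at hG
      simp [multiples, hG]
    rw [this]
    simp [koszulDim_empty]
  | succ N ih =>
    rcases G.eq_empty_or_nonempty with rfl | ⟨m, hm⟩
    · exact (ih ∅ (by simp) i T).trans (Nat.choose_le_choose _ N.le_succ)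
    have hcard : (G.erase m).card ≤ N := by
      rw [Finset.card_erase_of_mem hm]
      omega
    have hG' : multiples G = multiples (G.erase m) ∪ Set.Ici m := by
      ext q
      constructor
      · rintro ⟨g, hg, hgq⟩
        by_cases h : g = m
        · exact Or.inr (h ▸ hgq)
        · exact Or.inl ⟨g, Finset.mem_erase.2 ⟨h, hg⟩, hgq⟩
      · rintro (⟨g, hg, hgq⟩ | h)
        · exact ⟨g, Finset.mem_of_mem_erase hg, hgq⟩
        · exact ⟨m, hm, h⟩
    have hcolon : {q | q + m ∈ multiples (G.erase m)} =
        multiples ((G.erase m).image (· - m)) := by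
      ext q
      simp [multiples, tsub_le_iff_right]
    have hup := isUpperSet_multiples (G.erase m)
    rw [hG']
    cases i with
    | zero =>
      refine (Finset.sum_le_sum fun t _ => koszulDim_zero_union_Ici_le _ m t).trans ?_
      rw [Finset.sum_add_distrib, zero_add, Nat.choose_one_right]
      refine add_le_add ((ih _ hcard 0 T).trans (Nat.choose_one_right N).le) ?_
      rw [Finset.sum_ite_eq']
      split_ifs <;> simp
    | succ i =>
      refine (Finset.sum_le_sum fun t _ => koszulDim_succ_union_Ici_le hup m i t).trans ?_
      rw [Finset.sum_add_distrib, Nat.choose_succ_succ, add_comm]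
      refine add_le_add ?_ (ih _ hcard (i + 1) T)
      rw [hcolon, ← Finset.sum_filter]
      refine le_trans (le_of_eq ?_) (ih ((G.erase m).image (· - m))
        (Finset.card_image_le.trans hcard) i ((T.filter (m.degree ≤ ·)).image (· - m.degree)))
      rw [Finset.sum_image]
      intro a ha b hb hab
      simp only [Finset.coe_filter, Set.mem_ofPred_eq] at ha hb hab
      omega

/-- In internal degree at most `p + j`, Koszul homology of homological degree `p` only sees the
components of degree at most `j`. -/
lemma koszulDim_le_of_forall_degree_le {D D' : Set (Fin n →₀ ℕ)} (h : D' ⊆ D) {p t j : ℕ}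
    (hj : ∀ m ∈ D, m.degree ≤ j → m ∈ D') (ht : t ≤ p + j) :
    koszulDim n (monoPiece k D) p t ≤ koszulDim n (monoPiece k D') p t := by
  refine relDim_le_of_correspondence ⊤ LinearMap.id LinearMap.id ?_ ?_
  · intro z hz
    refine ⟨z, trivial, rfl, ?_, hz.2⟩
    refine koszulPiece_mono ?_ hz.1
    intro e he q hq m hm
    obtain ⟨h₁, h₂⟩ := hq m hm
    exact ⟨hj m h₁ (by omega), h₂⟩
  · intro z _ _ hz
    exact Submodule.map_mono (koszulPiece_monoPiece_mono h _ _) hz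

end Monomial

/-! ### Degeneration to the initial ideal -/

section Initial

open Module

variable {k : Type u} [Field k] {n : ℕ}

/-- The forms of degree `e` in the ideal `I`. -/
noncomputable def idealPiece (I : Ideal (MvPolynomial (Fin n) k)) (e : ℕ) :
    Submodule k (MvPolynomial (Fin n) k) :=
  I.restrictScalars k ⊓ homogeneousSubmodule (Fin n) k e

lemma isHomogeneous_iff_degree {p : MvPolynomial (Fin n) k} {e : ℕ} :
    p.IsHomogeneous e ↔ ∀ m, coeff m p ≠ 0 → m.degree = e := by
  refine forall_congr' fun m => ?_
  rw [Finsupp.degree_eq_weight_one]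
  exact Iff.rfl

lemma X_smul_mem_idealPiece (I : Ideal (MvPolynomial (Fin n) k)) (e : ℕ) (a : Fin n)
    (p : MvPolynomial (Fin n) k) (hp : p ∈ idealPiece I e) :
    (X a : MvPolynomial (Fin n) k) • p ∈ idealPiece I (e + 1) := by
  refine ⟨I.mul_mem_left _ hp.1, ?_⟩
  rw [add_comm]
  exact (isHomogeneous_X k a).mul hp.2

lemma mem_koszulPiece_idealPiece {I : Ideal (MvPolynomial (Fin n) k)} {p t : ℕ}
    {f : Finset (Fin n) → MvPolynomial (Fin n) k} :
    f ∈ koszulPiece (idealPiece I) p t ↔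
      ∀ A, f A ∈ I ∧ ∀ m, coeff m (f A) ≠ 0 → A.card = p ∧ p + m.degree = t := by
  rw [mem_koszulPiece]
  refine forall_congr' fun A => ?_
  constructor
  · intro h
    by_cases hA : f A = 0
    · rw [hA]
      exact ⟨zero_mem _, fun m hm => absurd (coeff_zero m) hm⟩
    · obtain ⟨e, hc, he, hI, hh⟩ := h hA
      refine ⟨hI, fun m hm => ⟨hc, ?_⟩⟩
      rw [isHomogeneous_iff_degree.1 hh m hm, he]
  · rintro ⟨hI, h⟩ hA
    obtain ⟨m, hm⟩ := MvPolynomial.ne_zero_iff.1 hA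
    obtain ⟨hc, he⟩ := h m hm
    refine ⟨m.degree, hc, he, hI, isHomogeneous_iff_degree.2 fun m' hm' => ?_⟩
    have := (h m' hm').2
    omega

instance (I : Ideal (MvPolynomial (Fin n) k)) (p t : ℕ) :
    FiniteDimensional k (koszulPiece (n := n) (idealPiece I) p t) :=
  finiteDimensional_koszulPiece (fun _ => inf_le_right) p t

instance (I : Ideal (MvPolynomial (Fin n) k)) (p t : ℕ) :
    FiniteDimensional k (koszulCycles (n := n) (idealPiece I) p t) :=
  Submodule.finiteDimensional_inf_left _ _

instance (I : Ideal (MvPolynomial (Fin n) k)) (p t : ℕ) :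
    FiniteDimensional k (koszulBoundaries (n := n) (idealPiece I) p t) :=
  inferInstanceAs (FiniteDimensional k ((koszulPiece (idealPiece I) (p + 1) t).map koszulX))

variable (mo : MonomialOrder (Fin n))

/-- The exponents of the leading monomials of the elements of `I`. -/
def initialExponents (I : Ideal (MvPolynomial (Fin n) k)) : Set (Fin n →₀ ℕ) :=
  {d | ∃ f ∈ I, f ≠ 0 ∧ mo.degree f = d}

lemma isUpperSet_initialExponents (I : Ideal (MvPolynomial (Fin n) k)) :
    IsUpperSet (initialExponents mo I) := by
  classical
  rintro a b hab ⟨f, hf, hf0, rfl⟩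
  have h1 : monomial (b - mo.degree f) (1 : k) ≠ 0 := by simp
  refine ⟨monomial (b - mo.degree f) 1 * f, I.mul_mem_left _ hf, mul_ne_zero h1 hf0, ?_⟩
  rw [mo.degree_mul h1 hf0, mo.degree_monomial, if_neg one_ne_zero, tsub_add_cancel_of_le hab]

lemma finrank_le_of_leading_multiComp {p t : ℕ}
    {V U : Submodule k (Finset (Fin n) → MvPolynomial (Fin n) k)}
    [FiniteDimensional k V] [FiniteDimensional k U]
    (hV : ∀ f ∈ V, ∀ A m, coeff m (f A) ≠ 0 → A.card = p ∧ p + m.degree = t)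
    (hlead : ∀ μ, ∀ x ∈ V, (∀ ν, mo.toSyn μ < mo.toSyn ν → multiComp ν x = 0) →
      ∃ y ∈ U, (∀ ν, mo.toSyn μ < mo.toSyn ν → multiComp ν y = 0) ∧
        multiComp μ y = multiComp μ x) :
    finrank k V ≤ finrank k U := by
  classical
  have hfin : {μ : Fin n →₀ ℕ | μ.degree ≤ t}.Finite := Finsupp.finite_of_degree_le t
  refine finrank_le_of_leading (fun s => multiComp (mo.toSyn.symm s)) V U
    (hfin.toFinset.image mo.toSyn) ?_ ?_ ?_
  · intro x hx s hs
    ext A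
    by_contra h
    have hle := sqfree_le_of_multiComp_ne_zero h
    rw [multiComp_apply, if_pos hle] at h
    obtain ⟨hc, he⟩ := hV x hx A _ h
    refine hs (Finset.mem_image.2 ⟨mo.toSyn.symm s, ?_, by simp⟩)
    rw [Set.Finite.mem_toFinset, Set.mem_ofPred_eq, ← tsub_add_cancel_of_le hle, map_add,
      degree_sqfree]
    omega
  · intro x _ h
    refine ext_multiComp fun μ => ?_
    rw [map_zero]
    simpa using h (mo.toSyn μ)
  · intro s x hx h
    obtain ⟨y, hy, h₁, h₂⟩ := hlead (mo.toSyn.symm s) x hx fun ν hν => by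
      simpa using h (mo.toSyn ν) (by simpa using hν)
    exact ⟨y, hy, fun s' hs' => h₁ _ (by simpa using hs'), h₂⟩

lemma multiComp_multiEmbed_multiComp (ν μ : Fin n →₀ ℕ)
    (x : Finset (Fin n) → MvPolynomial (Fin n) k) :
    multiComp ν (multiEmbed μ (multiComp μ x)) = if ν = μ then multiComp μ x else 0 :=
  multiComp_multiEmbed _ _ _ fun _ hA => sqfree_le_of_multiComp_ne_zero hA

/-- The leading multihomogeneous component of an element of the Koszul complex of `I` lies in the
Koszul complex of the initial ideal. -/
lemma multiEmbed_multiComp_mem {I : Ideal (MvPolynomial (Fin n) k)} {p t : ℕ} {μ : Fin n →₀ ℕ}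
    {x : Finset (Fin n) → MvPolynomial (Fin n) k} (hx : x ∈ koszulPiece (idealPiece I) p t)
    (h : ∀ ν, mo.toSyn μ < mo.toSyn ν → multiComp ν x = 0) :
    multiEmbed μ (multiComp μ x) ∈ koszulPiece (monoPiece k (initialExponents mo I)) p t := by
  rw [mem_koszulPiece_idealPiece] at hx
  rw [mem_koszulPiece_monoPiece]
  intro A m hm
  rw [← multiComp_add_sqfree, multiComp_multiEmbed_multiComp] at hm
  split_ifs at hm with hμ
  · subst hμ
    rw [multiComp_add_sqfree] at hm
    refine ⟨((hx A).2 m hm).1, ((hx A).2 m hm).2, x A, (hx A).1, ?_, ?_⟩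
    · intro h0
      rw [h0, coeff_zero] at hm
      exact hm rfl
    · refine mo.toSyn.injective (le_antisymm ?_ (mo.le_degree (mem_support_iff.2 hm)))
      by_contra hlt
      have h' := congrFun (h (mo.degree (x A) + sqfree A) (by
        rw [map_add, map_add]
        exact add_lt_add_left (not_le.1 hlt) _)) A
      rw [multiComp_add_sqfree, Pi.zero_apply, mo.coeff_degree_eq_zero_iff] at h'
      rw [h', coeff_zero] at hm
      exact hm rfl
  · exact absurd rfl hm

lemma finrank_koszulPiece_idealPiece_le (I : Ideal (MvPolynomial (Fin n) k)) (p t : ℕ) :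
    finrank k (koszulPiece (n := n) (idealPiece I) p t) ≤
      finrank k (koszulPiece (n := n) (monoPiece k (initialExponents mo I)) p t) := by
  refine finrank_le_of_leading_multiComp mo
    (fun f hf A => (mem_koszulPiece_idealPiece.1 hf A).2) fun μ x hx h =>
      ⟨_, multiEmbed_multiComp_mem mo hx h, fun ν hν => ?_, ?_⟩
  · rw [multiComp_multiEmbed_multiComp, if_neg]
    rintro rfl
    exact hν.false
  · rw [multiComp_multiEmbed_multiComp, if_pos rfl]

lemma finrank_koszulCycles_idealPiece_le (I : Ideal (MvPolynomial (Fin n) k)) (p t : ℕ) :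
    finrank k (koszulCycles (n := n) (idealPiece I) p t) ≤
      finrank k (koszulCycles (n := n) (monoPiece k (initialExponents mo I)) p t) := by
  refine finrank_le_of_leading_multiComp mo
    (fun f hf A => (mem_koszulPiece_idealPiece.1 hf.1 A).2) fun μ x hx h =>
      ⟨_, ⟨multiEmbed_multiComp_mem mo hx.1 h, ?_⟩, fun ν hν => ?_, ?_⟩
  · change koszulX (k := k) _ = 0
    refine ext_multiComp fun ν => ?_
    rw [koszulX_apply, multiComp_koszul, multiComp_multiEmbed_multiComp, map_zero]
    split_ifs
    · rw [← multiComp_koszul, ← koszulX_apply, LinearMap.mem_ker.1 hx.2, map_zero]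
    · rw [map_zero]
  · rw [multiComp_multiEmbed_multiComp, if_neg]
    rintro rfl
    exact hν.false
  · rw [multiComp_multiEmbed_multiComp, if_pos rfl]

lemma exists_form_of_mem_initialExponents {I : Ideal (MvPolynomial (Fin n) k)}
    (hI : I.IsHomogeneous (homogeneousSubmodule (Fin n) k)) {d : Fin n →₀ ℕ}
    (hd : d ∈ initialExponents mo I) :
    ∃ f ∈ idealPiece I d.degree, coeff d f = 1 ∧
      ∀ m, mo.toSyn d < mo.toSyn m → coeff m f = 0 := by
  obtain ⟨f, hf, hf0, rfl⟩ := hd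
  have hlc : mo.leadingCoeff f ≠ 0 := mo.leadingCoeff_ne_zero_iff.2 hf0
  refine ⟨(mo.leadingCoeff f)⁻¹ • homogeneousComponent (mo.degree f).degree f,
    Submodule.smul_mem _ _ ⟨homogeneousComponent_mem_of_mem hI hf _,
      homogeneousComponent_isHomogeneous _ _⟩, ?_, ?_⟩
  · rw [coeff_smul, coeff_homogeneousComponent, if_pos rfl]
    exact inv_mul_cancel₀ hlc
  · intro m hm
    rw [coeff_smul, coeff_homogeneousComponent, mo.coeff_eq_zero_of_lt hm, ite_self, smul_zero]

lemma finrank_koszulPiece_initial_le {I : Ideal (MvPolynomial (Fin n) k)}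
    (hI : I.IsHomogeneous (homogeneousSubmodule (Fin n) k)) (p t : ℕ) :
    finrank k (koszulPiece (n := n) (monoPiece k (initialExponents mo I)) p t) ≤
      finrank k (koszulPiece (n := n) (idealPiece I) p t) := by
  have hF : ∀ d : Fin n →₀ ℕ, ∃ f : MvPolynomial (Fin n) k, d ∈ initialExponents mo I →
      f ∈ idealPiece I d.degree ∧ coeff d f = 1 ∧
        ∀ m, mo.toSyn d < mo.toSyn m → coeff m f = 0 := by
    intro d
    by_cases hd : d ∈ initialExponents mo I
    · obtain ⟨f, hf⟩ := exists_form_of_mem_initialExponents mo hI hd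
      exact ⟨f, fun _ => hf⟩
    · exact ⟨0, fun h => absurd h hd⟩
  choose F hF using hF
  refine finrank_le_of_leading_multiComp mo (fun f hf A m hm =>
    ⟨(mem_koszulPiece_monoPiece.1 hf A m hm).1, (mem_koszulPiece_monoPiece.1 hf A m hm).2.1⟩) ?_
  intro μ x hx h
  have hx' : ∀ A, multiComp μ x A ≠ 0 → A.card = p ∧ sqfree A ≤ μ ∧
      p + (μ - sqfree A).degree = t ∧ μ - sqfree A ∈ initialExponents mo I := by
    intro A hA
    have hle := sqfree_le_of_multiComp_ne_zero hA
    rw [multiComp_apply, if_pos hle] at hA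
    obtain ⟨h₁, h₂, h₃⟩ := mem_koszulPiece_monoPiece.1 hx A _ hA
    exact ⟨h₁, hle, h₂, h₃⟩
  refine ⟨fun A => multiComp μ x A • F (μ - sqfree A), ?_, fun ν hν => ?_, ?_⟩
  · rw [mem_koszulPiece]
    intro A hA
    obtain ⟨hc, -, he, hd⟩ := hx' A fun h0 => hA (by rw [h0, zero_smul])
    exact ⟨_, hc, he, Submodule.smul_mem _ _ (hF _ hd).1⟩
  · ext A
    rw [multiComp_apply]
    split_ifs with hle
    · by_cases h0 : multiComp μ x A = 0
      · rw [h0, zero_smul, coeff_zero, Pi.zero_apply]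
      · obtain ⟨-, hle', -, hd⟩ := hx' A h0
        rw [coeff_smul, (hF _ hd).2.2, smul_zero, Pi.zero_apply]
        rw [← tsub_add_cancel_of_le hle, ← tsub_add_cancel_of_le hle', map_add, map_add] at hν
        exact lt_of_add_lt_add_right hν
    · rfl
  · ext A
    by_cases h0 : multiComp μ x A = 0
    · rw [multiComp_apply, h0]
      split_ifs
      · rw [zero_smul, coeff_zero]
      · rfl
    · obtain ⟨-, hle, -, hd⟩ := hx' A h0
      rw [multiComp_apply, if_pos hle, coeff_smul, (hF _ hd).2.1, smul_eq_mul, mul_one]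

lemma finrank_koszulBoundaries_add (𝓜 : ℕ → Submodule k (MvPolynomial (Fin n) k)) {p q : ℕ}
    (hq : p + 1 = q) (t : ℕ) [FiniteDimensional k (koszulPiece (n := n) 𝓜 q t)] :
    finrank k (koszulBoundaries (n := n) 𝓜 p t) + finrank k (koszulCycles (n := n) 𝓜 q t) =
      finrank k (koszulPiece (n := n) 𝓜 q t) := by
  subst hq
  exact finrank_map_add_finrank_inf_ker (koszulPiece 𝓜 (p + 1) t) koszulX

/-- Graded Betti numbers do not decrease under passage to the initial ideal. -/
lemma koszulDim_idealPiece_le {I : Ideal (MvPolynomial (Fin n) k)}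
    (hI : I.IsHomogeneous (homogeneousSubmodule (Fin n) k)) (p t : ℕ) :
    koszulDim n (idealPiece I) p t ≤ koszulDim n (monoPiece k (initialExponents mo I)) p t := by
  have h₁ := relDim_add_finrank (koszulBoundaries_le_koszulCycles (X_smul_mem_idealPiece I) p t)
  have h₂ := relDim_add_finrank (koszulBoundaries_le_koszulCycles
    (X_smul_mem_monoPiece (k := k) (isUpperSet_initialExponents mo I)) p t)
  have h₃ := finrank_koszulBoundaries_add (idealPiece I) (Eq.refl (p + 1)) t
  have h₄ := finrank_koszulBoundaries_add (monoPiece k (initialExponents mo I))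
    (Eq.refl (p + 1)) t
  have h₅ := finrank_koszulCycles_idealPiece_le mo I p t
  have h₆ := finrank_koszulCycles_idealPiece_le mo I (p + 1) t
  have h₇ := finrank_koszulPiece_initial_le mo hI (p + 1) t
  rw [koszulDim, koszulDim]
  omega

/-- The minimal generators of the initial ideal of degree `t` which do not come from generators of
`I` are accounted for by first syzygies of the initial ideal. -/
lemma koszulDim_zero_initial_le (I : Ideal (MvPolynomial (Fin n) k))
    (hI : I.IsHomogeneous (homogeneousSubmodule (Fin n) k)) (t : ℕ) :
    koszulDim n (monoPiece k (initialExponents mo I)) 0 t ≤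
      koszulDim n (idealPiece I) 0 t +
        koszulDim n (monoPiece k (initialExponents mo I)) 1 t := by
  have hJ := X_smul_mem_monoPiece (k := k) (isUpperSet_initialExponents mo I)
  have h₁ := relDim_add_finrank (koszulBoundaries_le_koszulCycles (X_smul_mem_idealPiece I) 0 t)
  have h₂ := relDim_add_finrank (koszulBoundaries_le_koszulCycles hJ 0 t)
  have h₃ := relDim_add_finrank (koszulBoundaries_le_koszulCycles hJ 1 t)
  have h₄ := finrank_koszulBoundaries_add (idealPiece I) (zero_add 1) t
  have h₅ := finrank_koszulBoundaries_add (monoPiece k (initialExponents mo I)) (zero_add 1) t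
  have h₆ := finrank_koszulBoundaries_add (idealPiece I) one_add_one_eq_two t
  have h₇ := finrank_koszulBoundaries_add (monoPiece k (initialExponents mo I))
    one_add_one_eq_two t
  have h₈ := finrank_koszulCycles_idealPiece_le mo I 2 t
  have h₉ := finrank_koszulPiece_initial_le mo hI 2 t
  have h₁₀ := finrank_koszulPiece_idealPiece_le mo I 1 t
  have h₁₁ := finrank_koszulPiece_initial_le mo hI 0 t
  have h₁₂ := Submodule.finrank_mono
    (koszulBoundaries_le_koszulCycles (X_smul_mem_idealPiece I) 1 t)
  rw [← koszulCycles_zero, ← koszulCycles_zero] at h₁₁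
  rw [koszulDim, koszulDim, koszulDim]
  omega

end Initial

/-! ### Comparison of a graded free resolution with the Koszul complex -/

section Free

variable {k : Type u} [Field k] {n : ℕ} {B B' : Type u} {deg : B → ℕ} {deg' : B' → ℕ}

lemma isHomog_iff {x : B →₀ MvPolynomial (Fin n) k} {d : ℕ} :
    IsHomog deg x d ↔ ∀ b m, coeff m (x b) ≠ 0 → deg b + m.degree = d := by
  refine forall_congr' fun b => ?_
  constructor
  · intro h m hm
    obtain ⟨e, he, hh⟩ := h fun h0 => hm (by rw [h0, coeff_zero])
    rw [isHomogeneous_iff_degree.1 hh m hm, he]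
  · intro h hb
    obtain ⟨m, hm⟩ := MvPolynomial.ne_zero_iff.1 hb
    refine ⟨m.degree, h m hm, isHomogeneous_iff_degree.2 fun m' hm' => ?_⟩
    have := h m hm
    have := h m' hm'
    omega

/-- The component of degree `d` of `⨁_b S(-deg b)`. -/
def freePiece (deg : B → ℕ) (d : ℕ) : Submodule k (B →₀ MvPolynomial (Fin n) k) where
  carrier := {x | IsHomog deg x d}
  zero_mem' b h := absurd rfl h
  add_mem' := by
    intro x y hx hy
    rw [Set.mem_ofPred_eq, isHomog_iff] at hx hy ⊢
    intro b m h
    by_cases h0 : coeff m (x b) = 0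
    · exact hy b m fun h1 => h (by rw [Finsupp.add_apply, coeff_add, h0, h1, add_zero])
    · exact hx b m h0
  smul_mem' := by
    intro c x hx
    rw [Set.mem_ofPred_eq, isHomog_iff] at hx ⊢
    intro b m h
    exact hx b m fun h0 => h (by rw [Finsupp.smul_apply, coeff_smul, h0, smul_zero])

lemma mem_freePiece {x : B →₀ MvPolynomial (Fin n) k} {d : ℕ} :
    x ∈ freePiece deg d ↔ IsHomog deg x d := Iff.rfl

lemma X_smul_mem_freePiece (deg : B → ℕ) (e : ℕ) (a : Fin n) (x : B →₀ MvPolynomial (Fin n) k)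
    (hx : x ∈ freePiece deg e) :
    (X a : MvPolynomial (Fin n) k) • x ∈ freePiece (k := k) deg (e + 1) := by
  intro b hb
  rw [Finsupp.smul_apply, smul_eq_mul] at hb ⊢
  obtain ⟨d, hd, hh⟩ := hx b (right_ne_zero_of_mul hb)
  exact ⟨1 + d, by omega, (isHomogeneous_X k a).mul hh⟩

lemma mem_koszulPiece_freePiece {p t : ℕ} {f : Finset (Fin n) → B →₀ MvPolynomial (Fin n) k} :
    f ∈ koszulPiece (k := k) (freePiece deg) p t ↔
      ∀ A b m, coeff m (f A b) ≠ 0 → A.card = p ∧ p + (deg b + m.degree) = t := by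
  rw [mem_koszulPiece]
  refine forall_congr' fun A => ?_
  constructor
  · intro h b m hm
    obtain ⟨e, hc, he, hh⟩ := h fun h0 => hm (by rw [h0, Finsupp.zero_apply, coeff_zero])
    rw [isHomog_iff.1 hh b m hm]
    exact ⟨hc, he⟩
  · intro h hA
    obtain ⟨b, hb⟩ := Finsupp.ne_iff.1 hA
    obtain ⟨m, hm⟩ := MvPolynomial.ne_zero_iff.1 hb
    refine ⟨deg b + m.degree, (h b m hm).1, (h b m hm).2, isHomog_iff.2 fun b' m' hm' => ?_⟩
    have := (h b m hm).2
    have := (h b' m' hm').2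
    omega

/-- Acyclicity of the Koszul complex with coefficients in a graded free module. -/
lemma exists_koszulX_eq_free {p t : ℕ} {z : Finset (Fin n) → B →₀ MvPolynomial (Fin n) k}
    (hz : z ∈ koszulPiece (k := k) (freePiece deg) p t) (hz₀ : koszulX (k := k) z = 0)
    (hz₁ : ∀ b, coeff 0 (z ∅ b) = 0) :
    ∃ y ∈ koszulPiece (k := k) (freePiece deg) (p + 1) t, koszulX (k := k) y = z := by
  classical
  have hb : ∀ (f : Finset (Fin n) → B →₀ MvPolynomial (Fin n) k) (b : B),
      koszul (X : Fin n → MvPolynomial (Fin n) k) (fun A => f A b) =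
        fun A => koszul (X : Fin n → MvPolynomial (Fin n) k) f A b :=
    fun f b => koszul_map X (Finsupp.lapply b) f
  have h : ∀ b, ∃ w : Finset (Fin n) → MvPolynomial (Fin n) k,
      koszul (X : Fin n → MvPolynomial (Fin n) k) w = (fun A => z A b) ∧
        ∀ A m, coeff m (w A) ≠ 0 →
          ∃ a ∈ A, coeff (m + Finsupp.single a 1) (z (A.erase a) b) ≠ 0 := by
    intro b
    refine exists_koszul_eq ?_ (hz₁ b)
    rw [hb, ← koszulX_apply, hz₀]
    rfl
  choose w hw hw' using h
  let T : Finset B := Finset.univ.biUnion fun A => (z A).support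
  have hy : ∀ A b, Finsupp.indicator T (fun b _ => w b A) b = if b ∈ T then w b A else 0 := by
    intro A b
    rw [Finsupp.indicator_apply]
    split_ifs <;> rfl
  refine ⟨fun A => Finsupp.indicator T fun b _ => w b A,
    mem_koszulPiece_freePiece.2 fun A b m hm => ?_, ?_⟩
  · rw [hy] at hm
    split_ifs at hm with hbT
    · obtain ⟨a, ha, haz⟩ := hw' b A m hm
      obtain ⟨hc, he⟩ := mem_koszulPiece_freePiece.1 hz _ _ _ haz
      rw [Finset.card_erase_of_mem ha] at hc
      have := Finset.card_pos.2 ⟨a, ha⟩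
      rw [map_add, Finsupp.degree_single] at he
      exact ⟨by omega, by omega⟩
    · exact absurd (coeff_zero m) hm
  · ext1 A
    ext1 b
    have h := congrFun (hb (fun A => Finsupp.indicator T fun b _ => w b A) b) A
    rw [koszulX_apply, ← h]
    simp only [hy]
    by_cases hbT : b ∈ T
    · simp only [if_pos hbT]
      exact congrFun (hw b) A
    · simp only [if_neg hbT]
      have h0 : z A b = 0 := by
        by_contra h0
        exact hbT (Finset.mem_biUnion.2 ⟨A, Finset.mem_univ A, Finsupp.mem_support_iff.2 h0⟩)
      rw [h0]
      exact congrFun (map_zero (koszul (X : Fin n → MvPolynomial (Fin n) k))) A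

lemma map_comp_of_homog (φ : (B →₀ MvPolynomial (Fin n) k) →ₗ[MvPolynomial (Fin n) k]
      (B' →₀ MvPolynomial (Fin n) k))
    (hφ : ∀ b, IsHomog deg' (φ (Finsupp.single b 1)) (deg b)) (d : ℕ)
    (x : B →₀ MvPolynomial (Fin n) k) : φ (comp deg d x) = comp deg' d (φ x) := by
  induction x using Finsupp.induction_linear with
  | zero => simp
  | add f g hf hg => simp only [map_add, hf, hg]
  | single b p =>
    have h : ∀ q : MvPolynomial (Fin n) k,
        Finsupp.single b q = q • Finsupp.single b (1 : MvPolynomial (Fin n) k) := by simp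
    rw [comp_single, h, map_smul, h p, map_smul, comp_smul (hφ b)]

/-- `φ` is a homomorphism of graded modules, of degree zero, from `⨁_b S(-deg b)` to the module with
components `𝒩 e`. The second condition holds automatically if these components are independent. -/
structure IsGradedHom {N : Type u} [AddCommGroup N] [Module k N] [Module (MvPolynomial (Fin n) k) N]
    (deg : B → ℕ) (𝒩 : ℕ → Submodule k N)
    (φ : (B →₀ MvPolynomial (Fin n) k) →ₗ[MvPolynomial (Fin n) k] N) : Prop where
  map_mem : ∀ e, ∀ x ∈ freePiece (k := k) deg e, φ x ∈ 𝒩 e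
  exists_lift : ∀ e, ∀ y ∈ LinearMap.range φ, y ∈ 𝒩 e → ∃ x ∈ freePiece (k := k) deg e, φ x = y

lemma isGradedHom_free (φ : (B →₀ MvPolynomial (Fin n) k) →ₗ[MvPolynomial (Fin n) k]
      (B' →₀ MvPolynomial (Fin n) k))
    (hφ : ∀ b, IsHomog deg' (φ (Finsupp.single b 1)) (deg b)) :
    IsGradedHom (k := k) deg (freePiece deg') φ where
  map_mem e x hx := by
    have h := comp_of_isHomog hx e
    rw [if_pos rfl] at h
    rw [← h, map_comp_of_homog φ hφ]
    exact comp_isHomog e (φ x)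
  exists_lift e := by
    rintro _ ⟨x, rfl⟩ hy
    refine ⟨comp deg e x, comp_isHomog e x, ?_⟩
    rw [map_comp_of_homog φ hφ, comp_of_isHomog hy, if_pos rfl]

lemma isGradedHom_of_isHomogeneous
    (φ : (B →₀ MvPolynomial (Fin n) k) →ₗ[MvPolynomial (Fin n) k] MvPolynomial (Fin n) k)
    (hφ : ∀ b, (φ (Finsupp.single b 1)).IsHomogeneous (deg b)) :
    IsGradedHom (k := k) deg (homogeneousSubmodule (Fin n) k) φ := by
  let ι := Finsupp.lsingle (R := MvPolynomial (Fin n) k) (M := MvPolynomial (Fin n) k)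
    (PUnit.unit : PUnit.{u + 1})
  have hι : ∀ p e, p ∈ homogeneousSubmodule (Fin n) k e ↔
      ι p ∈ freePiece (k := k) (fun _ : PUnit => 0) e := by
    intro p e
    rw [mem_freePiece, isHomog_iff, mem_homogeneousSubmodule, isHomogeneous_iff_degree]
    simp [ι]
  have hinj : Function.Injective ι := Finsupp.single_injective _
  have h := isGradedHom_free (deg := deg) (deg' := fun _ : PUnit => 0) (ι ∘ₗ φ)
    fun b => (hι _ _).1 (hφ b)
  refine ⟨fun e x hx => (hι _ _).2 (h.map_mem e x hx), ?_⟩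
  rintro e _ ⟨x, rfl⟩ hy
  obtain ⟨x', hx', h'⟩ := h.exists_lift e (ι (φ x)) ⟨x, rfl⟩ ((hι _ _).1 hy)
  exact ⟨x', hx', hinj h'⟩

/-- The homogeneous components of a graded submodule. -/
noncomputable def subPiece {N : Type u} [AddCommGroup N] [Module k N]
    [Module (MvPolynomial (Fin n) k) N]
    [IsScalarTower k (MvPolynomial (Fin n) k) N] (M : Submodule (MvPolynomial (Fin n) k) N)
    (𝒩 : ℕ → Submodule k N) (e : ℕ) : Submodule k N :=
  M.restrictScalars k ⊓ 𝒩 e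

/-- The Koszul homology of homological degree `p` and internal degree `t`. -/
noncomputable abbrev koszulHomology {N : Type u} [AddCommGroup N] [Module k N]
    [Module (MvPolynomial (Fin n) k) N] [IsScalarTower k (MvPolynomial (Fin n) k) N]
    (𝓜 : ℕ → Submodule k N) (p t : ℕ) :
    Submodule k ((Finset (Fin n) → N) ⧸ koszulBoundaries (n := n) 𝓜 p t) :=
  (koszulCycles 𝓜 p t).map (koszulBoundaries 𝓜 p t).mkQ

section DegreeZero

variable {N : Type u} [AddCommGroup N] [Module k N]

variable (k n)

/-- An element of `N`, as an element of homological degree zero of the Koszul complex of `N`. -/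
def degreeZero : N →ₗ[k] (Finset (Fin n) → N) := LinearMap.single k (fun _ => N) ∅

@[simp]
lemma degreeZero_empty (x : N) : degreeZero k n x ∅ = x :=
  Pi.single_eq_same (M := fun _ : Finset (Fin n) => N) ∅ x

lemma degreeZero_of_ne (x : N) {A : Finset (Fin n)} (hA : A ≠ ∅) : degreeZero k n x A = 0 :=
  Pi.single_eq_of_ne (M := fun _ : Finset (Fin n) => N) hA x

variable {k n}

lemma degreeZero_mem {𝓜 : ℕ → Submodule k N} {t : ℕ} {x : N} (hx : x ∈ 𝓜 t) :
    degreeZero k n x ∈ koszulPiece 𝓜 0 t := by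
  rw [mem_koszulPiece]
  intro A hA
  have hA' : A = ∅ := by
    by_contra h
    exact hA (degreeZero_of_ne k n x h)
  subst hA'
  exact ⟨t, Finset.card_empty, zero_add t, by rwa [degreeZero_empty]⟩

lemma apply_empty_mem {𝓜 : ℕ → Submodule k N} {t : ℕ} {f : Finset (Fin n) → N}
    (hf : f ∈ koszulPiece 𝓜 0 t) : f ∅ ∈ 𝓜 t := by
  by_cases h0 : f ∅ = 0
  · rw [h0]
    exact zero_mem _
  · obtain ⟨e, -, he, h⟩ := mem_koszulPiece.1 hf ∅ h0
    rwa [← he, zero_add]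

end DegreeZero

section GradedHom

variable {N : Type u} [AddCommGroup N] [Module k N] [Module (MvPolynomial (Fin n) k) N]
  [IsScalarTower k (MvPolynomial (Fin n) k) N] {𝒩 : ℕ → Submodule k N}
  {φ : (B →₀ MvPolynomial (Fin n) k) →ₗ[MvPolynomial (Fin n) k] N}

lemma koszulX_map (φ : (B →₀ MvPolynomial (Fin n) k) →ₗ[MvPolynomial (Fin n) k] N)
    (f : Finset (Fin n) → B →₀ MvPolynomial (Fin n) k) :
    koszulX (k := k) (φ.compLeft (Finset (Fin n)) f) =
      φ.compLeft (Finset (Fin n)) (koszulX (k := k) f) :=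
  koszul_map _ φ f

lemma IsGradedHom.map_mem_koszulPiece (hφ : IsGradedHom (k := k) deg 𝒩 φ) {p t : ℕ}
    {f : Finset (Fin n) → B →₀ MvPolynomial (Fin n) k}
    (hf : f ∈ koszulPiece (k := k) (freePiece deg) p t) :
    φ.compLeft (Finset (Fin n)) f ∈ koszulPiece (subPiece (LinearMap.range φ) 𝒩) p t := by
  rw [mem_koszulPiece] at hf ⊢
  intro A hA
  obtain ⟨e, hc, he, h⟩ := hf A fun h0 => hA (by
    rw [LinearMap.compLeft_apply, Function.comp_apply, h0, map_zero])
  exact ⟨e, hc, he, ⟨f A, rfl⟩, hφ.map_mem e _ h⟩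

lemma IsGradedHom.lift_koszulPiece (hφ : IsGradedHom (k := k) deg 𝒩 φ) {p t : ℕ}
    {u : Finset (Fin n) → N} (hu : u ∈ koszulPiece (subPiece (LinearMap.range φ) 𝒩) p t) :
    ∃ v ∈ koszulPiece (k := k) (freePiece deg) p t, φ.compLeft (Finset (Fin n)) v = u := by
  rw [mem_koszulPiece] at hu
  have h : ∀ A, ∃ x : B →₀ MvPolynomial (Fin n) k, φ x = u A ∧ (x ≠ 0 →
      ∃ e, A.card = p ∧ p + e = t ∧ x ∈ freePiece (k := k) deg e) := by
    intro A
    by_cases h0 : u A = 0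
    · exact ⟨0, by rw [map_zero, h0], fun h => absurd rfl h⟩
    · obtain ⟨e, hc, he, h₁, h₂⟩ := hu A h0
      obtain ⟨x, hx, hxu⟩ := hφ.exists_lift e _ h₁ h₂
      exact ⟨x, hxu, fun _ => ⟨e, hc, he, hx⟩⟩
  choose v hv hv' using h
  exact ⟨v, mem_koszulPiece.2 hv', funext hv⟩

omit [Module k N] [IsScalarTower k (MvPolynomial (Fin n) k) N] in
lemma mem_koszulPiece_ker {p t : ℕ} {f : Finset (Fin n) → B →₀ MvPolynomial (Fin n) k}
    (hf : f ∈ koszulPiece (k := k) (freePiece deg) p t)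
    (hφf : φ.compLeft (Finset (Fin n)) f = 0) :
    f ∈ koszulPiece (k := k) (subPiece (LinearMap.ker φ) (freePiece deg)) p t := by
  rw [mem_koszulPiece] at hf ⊢
  intro A hA
  obtain ⟨e, hc, he, h⟩ := hf A hA
  exact ⟨e, hc, he, congrFun hφf A, h⟩

omit [Module k N] [IsScalarTower k (MvPolynomial (Fin n) k) N] in
lemma compLeft_eq_zero {p t : ℕ} {f : Finset (Fin n) → B →₀ MvPolynomial (Fin n) k}
    (hf : f ∈ koszulPiece (k := k) (subPiece (LinearMap.ker φ) (freePiece deg)) p t) :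
    φ.compLeft (Finset (Fin n)) f = 0 := by
  ext1 A
  rw [LinearMap.compLeft_apply, Function.comp_apply, Pi.zero_apply]
  by_cases h0 : f A = 0
  · rw [h0, map_zero]
  · obtain ⟨e, -, -, h, -⟩ := mem_koszulPiece.1 hf A h0
    exact h

/-- If `φ w` is a boundary, then `w` may be changed by a boundary to have coefficients in
`ker φ`. -/
lemma IsGradedHom.exists_sub_mem (hφ : IsGradedHom (k := k) deg 𝒩 φ) {p t : ℕ}
    {w : Finset (Fin n) → B →₀ MvPolynomial (Fin n) k}
    (hw : w ∈ koszulPiece (k := k) (freePiece deg) p t)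
    (h : φ.compLeft (Finset (Fin n)) w ∈
      koszulBoundaries (n := n) (subPiece (LinearMap.range φ) 𝒩) p t) :
    ∃ w' ∈ koszulPiece (k := k) (subPiece (LinearMap.ker φ) (freePiece deg)) p t,
      koszulX (k := k) w' = koszulX (k := k) w := by
  obtain ⟨u, hu, huw⟩ := h
  obtain ⟨v, hv, rfl⟩ := hφ.lift_koszulPiece hu
  refine ⟨w - koszulX (k := k) v, mem_koszulPiece_ker
    (sub_mem hw (koszulX_mem_koszulPiece (X_smul_mem_freePiece deg) hv)) ?_, ?_⟩
  · rw [map_sub, ← huw, koszulX_map, sub_self]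
  · rw [map_sub, koszulX_koszulX, sub_zero]

/-- Dimension shifting: as Koszul homology vanishes on the free module, the connecting map
`H_{p+1}(range φ) → H_p(ker φ)` is bijective for `p > 0`; this is its inverse. -/
lemma IsGradedHom.exists_injective (hφ : IsGradedHom (k := k) deg 𝒩 φ) {p : ℕ} (hp : p ≠ 0)
    (t : ℕ) :
    ∃ f : koszulHomology (k := k) (n := n) (subPiece (LinearMap.ker φ) (freePiece deg)) p t
      →ₗ[k] koszulHomology (k := k) (n := n) (subPiece (LinearMap.range φ) 𝒩) (p + 1) t,
      Function.Injective f := by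
  refine exists_injective_of_correspondence (koszulPiece (k := k) (freePiece deg) (p + 1) t)
    koszulX ((φ.compLeft (Finset (Fin n))).restrictScalars k) ?_ ?_
  · intro z hz
    have hz' : z ∈ koszulPiece (k := k) (freePiece deg) p t :=
      koszulPiece_mono (fun _ _ => inf_le_right) hz.1
    obtain ⟨w, hw, hwz⟩ := exists_koszulX_eq_free hz' hz.2 fun b => by
      by_contra h0
      exact hp (mem_koszulPiece_freePiece.1 hz' _ _ _ h0).1.symm
    refine ⟨w, hw, hwz, hφ.map_mem_koszulPiece hw, ?_⟩
    change koszulX (k := k) (φ.compLeft _ w) = 0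
    rw [koszulX_map, hwz]
    exact compLeft_eq_zero hz.1
  · intro w hw _ h
    obtain ⟨w', hw', h'⟩ := hφ.exists_sub_mem hw h
    exact ⟨w', hw', h'⟩

end GradedHom

end Free

namespace GradedFreeResolution

variable {k : Type u} [Field k] {n : ℕ} {I : Ideal (MvPolynomial (Fin n) k)}
  (F : GradedFreeResolution I)

lemma isGradedHom_d (i : ℕ) :
    IsGradedHom (k := k) (F.deg (i + 1)) (freePiece (F.deg i)) (F.d i) :=
  isGradedHom_free _ (F.d_homog i)

lemma isGradedHom_aug :
    IsGradedHom (k := k) (F.deg 0) (homogeneousSubmodule (Fin n) k) F.aug :=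
  isGradedHom_of_isHomogeneous _ F.aug_homog

lemma subPiece_range_aug :
    subPiece (k := k) (LinearMap.range F.aug) (homogeneousSubmodule (Fin n) k) = idealPiece I := by
  rw [F.range_aug]
  rfl

/-- Dimension shifting along the resolution. -/
lemma exists_injective_range_d {q p r : ℕ} (hp : p ≠ 0) (hr : p + q + 1 = r) (t : ℕ) :
    ∃ f : koszulHomology (k := k) (n := n)
        (subPiece (LinearMap.range (F.d q)) (freePiece (F.deg q))) p t
      →ₗ[k] koszulHomology (k := k) (n := n) (idealPiece I) r t,
      Function.Injective f := by
  induction q generalizing p with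
  | zero =>
    subst hr
    rw [F.exact_zero, ← F.subPiece_range_aug]
    exact F.isGradedHom_aug.exists_injective hp t
  | succ q ih =>
    rw [F.exact_succ]
    obtain ⟨f, hf⟩ := (F.isGradedHom_d q).exists_injective hp t
    obtain ⟨g, hg⟩ := ih p.succ_ne_zero (by omega)
    exact ⟨g ∘ₗ f, hg.comp hf⟩

/-- The inclusion of constants `F i ⊗_S k → F i`. -/
noncomputable def constants (i : ℕ) :
    (F.B i →₀ k) →ₗ[k] (F.B i →₀ MvPolynomial (Fin n) k) :=
  Finsupp.mapRange.linearMap (Algebra.linearMap k (MvPolynomial (Fin n) k))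

/-- The reduction `F i → F i ⊗_S k` modulo `x₁, …, xₙ`. -/
noncomputable def reduce (i : ℕ) : (F.B i →₀ MvPolynomial (Fin n) k) →ₗ[k] (F.B i →₀ k) :=
  Finsupp.mapRange.linearMap (lcoeff k 0)

lemma reduce_apply (i : ℕ) (x : F.B i →₀ MvPolynomial (Fin n) k) (b : F.B i) :
    F.reduce i x b = coeff 0 (x b) := rfl

lemma reduce_constants (i : ℕ) (x : F.B i →₀ k) : F.reduce i (F.constants i x) = x := by
  ext b
  rw [reduce_apply]
  exact coeff_zero_C (x b)

lemma reduce_d (i : ℕ) (x : F.B (i + 1) →₀ MvPolynomial (Fin n) k) :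
    F.reduce i (F.d i x) = F.dk i (F.reduce (i + 1) x) :=
  (F.dk_reduce i x).symm

lemma constants_mem {i j : ℕ} {x : F.B i →₀ k} (hx : x ∈ F.component i j) :
    F.constants i x ∈ freePiece (F.deg i) j := by
  classical
  rw [mem_freePiece, isHomog_iff]
  intro b m hm
  have h : coeff m (C (x b) : MvPolynomial (Fin n) k) ≠ 0 := hm
  rw [coeff_C] at h
  split_ifs at h with h0
  · rw [component, Finsupp.mem_supported] at hx
    have hb : F.deg i b = j := hx (Finsupp.mem_support_iff.2 h)
    rw [← h0, map_zero, hb, add_zero]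
  · exact absurd rfl h

lemma reduce_mem {i j : ℕ} {x : F.B i →₀ MvPolynomial (Fin n) k}
    (hx : x ∈ freePiece (k := k) (F.deg i) j) : F.reduce i x ∈ F.component i j := by
  rw [component, Finsupp.mem_supported]
  intro b hb
  rw [Finset.mem_coe, Finsupp.mem_support_iff, reduce_apply] at hb
  have h := isHomog_iff.1 hx b 0 hb
  rw [map_zero, add_zero] at h
  exact h

lemma reduce_koszulX (i : ℕ) (v : Finset (Fin n) → F.B i →₀ MvPolynomial (Fin n) k)
    (A : Finset (Fin n)) : F.reduce i (koszulX (k := k) v A) = 0 := by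
  ext b
  rw [reduce_apply, koszulX_apply, koszul_apply, Finsupp.finsetSum_apply, coeff_sum]
  refine Finset.sum_eq_zero fun a _ => ?_
  rw [Finsupp.smul_apply, Finsupp.smul_apply, coeff_smul, smul_eq_mul, coeff_X_mul',
    if_neg (by simp), smul_zero]

lemma mem_boundaries {i t : ℕ} {x : F.B i →₀ k} (hx : x ∈ F.component i t)
    {v : Finset (Fin n) → F.B i →₀ MvPolynomial (Fin n) k}
    (hv : v ∈ koszulPiece (k := k) (freePiece (F.deg i)) 1 t)
    (h : F.constants i x - koszulX (k := k) v ∅ ∈ LinearMap.range (F.d i)) :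
    x ∈ F.boundaries i t := by
  have hv' : koszulX (k := k) v ∅ ∈ freePiece (k := k) (F.deg i) t :=
    apply_empty_mem (koszulX_mem_koszulPiece (X_smul_mem_freePiece (F.deg i)) hv)
  obtain ⟨y, hy, hxy⟩ := (F.isGradedHom_d i).exists_lift t _ h
    (sub_mem (F.constants_mem hx) hv')
  refine ⟨F.reduce (i + 1) y, F.reduce_mem hy, ?_⟩
  rw [← reduce_d, hxy, map_sub, reduce_constants, reduce_koszulX, sub_zero]

/-- `Tor_{i+1}` embeds into the first Koszul homology of the image `M` of the preceding map `φ`. -/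
lemma exists_injective_Tor_succ {N : Type u} [AddCommGroup N] [Module k N]
    [Module (MvPolynomial (Fin n) k) N] [IsScalarTower k (MvPolynomial (Fin n) k) N]
    {𝒩 : ℕ → Submodule k N} (i t : ℕ)
    {φ : (F.B i →₀ MvPolynomial (Fin n) k) →ₗ[MvPolynomial (Fin n) k] N}
    (hφ : IsGradedHom (k := k) (F.deg i) 𝒩 φ)
    (hex : LinearMap.range (F.d i) = LinearMap.ker φ) :
    ∃ f : (F.cycles (i + 1) t).map (F.boundaries (i + 1) t).mkQ →ₗ[k]
      koszulHomology (k := k) (n := n) (subPiece (LinearMap.range φ) 𝒩) 1 t,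
      Function.Injective f := by
  let E := Finset (Fin n) → F.B i →₀ MvPolynomial (Fin n) k
  let δ : (F.B (i + 1) →₀ k) →ₗ[k] E :=
    degreeZero k n ∘ₗ (F.d i).restrictScalars k ∘ₗ F.constants (i + 1)
  refine exists_injective_of_correspondence
    ((F.component (i + 1) t).prod (koszulPiece (k := k) (freePiece (F.deg i)) 1 t) ⊓
      LinearMap.ker (koszulX ∘ₗ LinearMap.snd k (F.B (i + 1) →₀ k) E - δ ∘ₗ LinearMap.fst k _ E))
    (LinearMap.fst k _ E)
    (((φ.compLeft (Finset (Fin n))).restrictScalars k) ∘ₗ LinearMap.snd k (F.B (i + 1) →₀ k) E)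
    ?_ ?_
  · intro x hx
    have hdx : δ x ∈ koszulPiece (k := k) (freePiece (F.deg i)) 0 t :=
      degreeZero_mem ((F.isGradedHom_d i).map_mem t _ (F.constants_mem hx.2))
    obtain ⟨w, hw, hwx⟩ := exists_koszulX_eq_free hdx
      ((koszulCycles_zero (freePiece (F.deg i)) t).ge hdx).2 fun b => by
        have h : F.reduce i (F.d i (F.constants (i + 1) x)) = 0 := by
          rw [reduce_d, reduce_constants]
          exact hx.1
        have h' : δ x ∅ = F.d i (F.constants (i + 1) x) := degreeZero_empty k n _
        rw [h', ← reduce_apply, h, Finsupp.zero_apply]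
    refine ⟨(x, w), ⟨⟨hx.2, hw⟩, ?_⟩, rfl, hφ.map_mem_koszulPiece hw, ?_⟩
    · change koszulX (k := k) w - δ x = 0
      rw [hwx, sub_self]
    · change koszulX (k := k) (φ.compLeft _ w) = 0
      rw [koszulX_map, hwx]
      ext1 A
      rw [LinearMap.compLeft_apply, Function.comp_apply, Pi.zero_apply, ← LinearMap.mem_ker, ← hex]
      by_cases hA : A = ∅
      · subst hA
        exact ⟨F.constants (i + 1) x, (degreeZero_empty k n _).symm⟩
      · exact ⟨0, (map_zero _).trans (degreeZero_of_ne k n _ hA).symm⟩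
  · rintro ⟨x, w⟩ ⟨⟨hx, hw⟩, hxw⟩ _ h
    obtain ⟨w', hw', hww'⟩ := hφ.exists_sub_mem hw h
    rw [← hex] at hw'
    obtain ⟨v, hv, rfl⟩ := (F.isGradedHom_d i).lift_koszulPiece hw'
    refine F.mem_boundaries hx hv ?_
    rw [F.exact_succ, LinearMap.mem_ker, map_sub, sub_eq_zero]
    have h₁ : koszulX (k := k) w = δ x := sub_eq_zero.1 hxw
    rw [koszulX_map, h₁] at hww'
    exact (degreeZero_empty k n _).symm.trans (congrFun hww' ∅).symm

lemma exists_injective_Tor_zero (t : ℕ) :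
    ∃ f : (F.cycles 0 t).map (F.boundaries 0 t).mkQ →ₗ[k]
      koszulHomology (k := k) (n := n) (idealPiece I) 0 t, Function.Injective f := by
  rw [← F.subPiece_range_aug]
  refine exists_injective_of_correspondence (F.component 0 t) LinearMap.id
    (degreeZero k n ∘ₗ F.aug.restrictScalars k ∘ₗ F.constants 0) ?_ ?_
  · intro x hx
    refine ⟨x, hx, rfl, (koszulCycles_zero _ t).ge (degreeZero_mem ⟨⟨_, rfl⟩, ?_⟩)⟩
    exact F.isGradedHom_aug.map_mem t _ (F.constants_mem hx)
  · rintro x hx - ⟨u, hu, hux⟩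
    obtain ⟨v, hv, rfl⟩ := F.isGradedHom_aug.lift_koszulPiece hu
    refine F.mem_boundaries hx hv ?_
    rw [F.exact_zero, LinearMap.mem_ker, map_sub, sub_eq_zero]
    rw [koszulX_map] at hux
    exact (degreeZero_empty k n _).symm.trans (congrFun hux ∅).symm

/-- `Tor_i^S(I, k)`, computed with a resolution of `I`, embeds into the Koszul homology of `I`. -/
lemma exists_injective_Tor (i t : ℕ) :
    ∃ f : (F.cycles i t).map (F.boundaries i t).mkQ →ₗ[k]
      koszulHomology (k := k) (n := n) (idealPiece I) i t, Function.Injective f := by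
  match i with
  | 0 => exact F.exists_injective_Tor_zero t
  | 1 =>
    rw [← F.subPiece_range_aug]
    exact F.exists_injective_Tor_succ 0 t F.isGradedHom_aug F.exact_zero
  | q + 2 =>
    obtain ⟨f, hf⟩ := F.exists_injective_Tor_succ (q + 1) t (F.isGradedHom_d q) (F.exact_succ q)
    obtain ⟨g, hg⟩ := F.exists_injective_range_d (q := q) (r := q + 2) one_ne_zero (by omega) t
    exact ⟨g ∘ₗ f, hg.comp hf⟩

lemma finrank_Tor_le (i t : ℕ) :
    Module.finrank k (F.Tor i t) ≤ koszulDim n (idealPiece I) i t := by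
  obtain ⟨f, hf⟩ := F.exists_injective_Tor i t
  rw [finrank_quotient_submoduleOf]
  exact LinearMap.finrank_le_finrank_of_injective hf

/-- The generators of `I` of degree `t` are counted by `Tor_0`. The previous embedding is used to
know that `Tor_0` is finite dimensional, so that its `finrank` is not a junk value. -/
lemma koszulDim_zero_le_finrank_Tor (t : ℕ) :
    koszulDim n (idealPiece I) 0 t ≤ Module.finrank k (F.Tor 0 t) := by
  obtain ⟨f, hf⟩ := F.exists_injective_Tor 0 t
  have hfin : Module.Finite k ((F.cycles 0 t).map (F.boundaries 0 t).mkQ) :=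
    Module.Finite.of_injective f hf
  have h : ∃ g : koszulHomology (k := k) (n := n) (idealPiece I) 0 t →ₗ[k]
      (F.cycles 0 t).map (F.boundaries 0 t).mkQ, Function.Injective g := by
    rw [← F.subPiece_range_aug]
    refine exists_injective_of_correspondence
      (koszulPiece (k := k) (freePiece (F.deg 0)) 0 t)
      ((F.aug.compLeft (Finset (Fin n))).restrictScalars k)
      (F.reduce 0 ∘ₗ LinearMap.proj ∅) ?_ ?_
    · intro z hz
      obtain ⟨w, hw, hwz⟩ := F.isGradedHom_aug.lift_koszulPiece hz.1
      refine ⟨w, hw, hwz, F.reduce_mem ?_⟩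
      exact apply_empty_mem hw
    · rintro w hw - ⟨y, hy, hyw⟩
      have hy' := degreeZero_mem (n := n)
        ((F.isGradedHom_d 0).map_mem t _ (F.constants_mem hy))
      have hsub := sub_mem hw hy'
      obtain ⟨v, hv, hvw⟩ := exists_koszulX_eq_free hsub
        ((koszulCycles_zero (freePiece (F.deg 0)) t).ge hsub).2 fun b => by
          have h : F.reduce 0 (w ∅ - F.d 0 (F.constants 1 y)) = 0 := by
            rw [map_sub, reduce_d, reduce_constants, sub_eq_zero]
            exact hyw.symm
          rw [Pi.sub_apply, degreeZero_empty, ← reduce_apply, h, Finsupp.zero_apply]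
      refine ⟨F.aug.compLeft _ v, F.isGradedHom_aug.map_mem_koszulPiece hv, ?_⟩
      rw [koszulX_map, hvw, map_sub]
      refine sub_eq_self.2 ?_
      ext1 A
      rw [LinearMap.compLeft_apply, Function.comp_apply, Pi.zero_apply, ← LinearMap.mem_ker,
        ← F.exact_zero]
      by_cases hA : A = ∅
      · subst hA
        exact ⟨F.constants 1 y, (degreeZero_empty k n _).symm⟩
      · exact ⟨0, (map_zero _).trans (degreeZero_of_ne k n _ hA).symm⟩
  obtain ⟨g, hg⟩ := h
  rw [finrank_quotient_submoduleOf]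
  exact LinearMap.finrank_le_finrank_of_injective hg

end GradedFreeResolution

/-! ### Counting the generators of the initial ideal -/

section Generators

variable {k : Type u} [Field k] {n : ℕ}

open scoped Classical in
/-- The exponents of the minimal monomial generators of degree at most `j` of a monomial ideal. -/
noncomputable def minGens (D : Set (Fin n →₀ ℕ)) (j : ℕ) : Finset (Fin n →₀ ℕ) :=
  {m ∈ (Finsupp.finite_of_degree_le (σ := Fin n) j).toFinset | Minimal (· ∈ D) m}

lemma mem_minGens {D : Set (Fin n →₀ ℕ)} {j : ℕ} {m : Fin n →₀ ℕ} :
    m ∈ minGens D j ↔ m.degree ≤ j ∧ Minimal (· ∈ D) m := by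
  simp [minGens]

lemma multiples_minGens_subset {D : Set (Fin n →₀ ℕ)} (hD : IsUpperSet D) (j : ℕ) :
    multiples (minGens D j) ⊆ D := by
  rintro m ⟨g, hg, hgm⟩
  exact hD hgm (mem_minGens.1 hg).2.prop

lemma mem_multiples_minGens {D : Set (Fin n →₀ ℕ)} {j : ℕ} {m : Fin n →₀ ℕ} (hm : m ∈ D)
    (hj : m.degree ≤ j) : m ∈ multiples (minGens D j) := by
  obtain ⟨g, hgm, hg⟩ := exists_minimal_le_of_wellFoundedLT (· ∈ D) m hm
  exact ⟨g, mem_minGens.2 ⟨(Finsupp.degree_mono hgm).trans hj, hg⟩, hgm⟩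

/-- The minimal monomial generators of degree `t` are linearly independent in `Tor_0`. -/
lemma card_le_koszulDim_zero {D : Set (Fin n →₀ ℕ)} {t : ℕ} (G : Finset (Fin n →₀ ℕ))
    (hG : ∀ m ∈ G, Minimal (· ∈ D) m ∧ m.degree = t) :
    G.card ≤ koszulDim n (monoPiece k D) 0 t := by
  classical
  have hcard : relDim (⊤ : Submodule k (G → k)) ⊥ = G.card := by
    have h := relDim_add_finrank (bot_le : (⊥ : Submodule k (G → k)) ≤ ⊤)
    rw [finrank_bot, add_zero, finrank_top, Module.finrank_pi] at h
    simpa using h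
  rw [← hcard]
  have hcoeff : ∀ (g : G → k) (m : G),
      coeff m.1 (∑ m' : G, monomial m'.1 (g m')) = g m := by
    intro g m
    rw [coeff_sum, Finset.sum_eq_single m]
    · rw [coeff_monomial, if_pos rfl]
    · intro b _ hb
      rw [coeff_monomial, if_neg fun h => hb (Subtype.ext h)]
    · intro h
      exact absurd (Finset.mem_univ m) h
  refine relDim_le_of_correspondence ⊤ LinearMap.id
    (degreeZero k n ∘ₗ ∑ m : G, monomial m.1 ∘ₗ LinearMap.proj m) ?_ ?_
  · intro g _
    refine ⟨g, trivial, rfl, (koszulCycles_zero _ t).ge (degreeZero_mem ?_)⟩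
    rw [LinearMap.sum_apply]
    refine Submodule.sum_mem _ fun m _ q hq => ?_
    rw [LinearMap.comp_apply, coeff_monomial] at hq
    split_ifs at hq with h
    · rw [← h]
      exact ⟨(hG m m.2).1.prop, (hG m m.2).2⟩
    · exact absurd rfl hq
  · rintro g - - ⟨u, hu, hug⟩
    rw [LinearMap.id_apply, Submodule.mem_bot]
    ext m
    have h := congrArg (coeff m.1) (congrFun hug ∅)
    rw [LinearMap.comp_apply, degreeZero_empty, LinearMap.sum_apply] at h
    rw [← hcoeff g m]
    refine h.symm.trans ?_
    rw [koszulX_apply, koszul_apply, coeff_sum]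
    refine Finset.sum_eq_zero fun a _ => ?_
    rw [coeff_smul, smul_eq_mul, coeff_X_mul']
    split_ifs with ha
    · by_contra h0
      have h0' : coeff (m.1 - Finsupp.single a 1) (u (insert a ∅)) ≠ 0 :=
        fun h1 => h0 (by rw [h1, smul_zero])
      have hD := (mem_koszulPiece_monoPiece.1 hu _ _ h0').2.2
      have hle := (hG m m.2).1.le_of_le hD tsub_le_self a
      rw [Finsupp.mem_support_iff] at ha
      rw [Finsupp.tsub_apply, Finsupp.single_eq_same] at hle
      omega
    · rw [smul_zero]

lemma card_minGens_succ_le (k : Type u) [Field k] (D : Set (Fin n →₀ ℕ)) (d : ℕ) :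
    (minGens D (d + 1)).card ≤ (minGens D d).card + koszulDim n (monoPiece k D) 0 (d + 1) := by
  classical
  have h : minGens D (d + 1) ⊆ minGens D d ∪ {m ∈ minGens D (d + 1) | m.degree = d + 1} := by
    intro m hm
    rw [Finset.mem_union, Finset.mem_filter]
    by_cases h : m.degree = d + 1
    · exact Or.inr ⟨hm, h⟩
    · rw [mem_minGens] at hm ⊢
      exact Or.inl ⟨by omega, hm.2⟩
  refine (Finset.card_le_card h).trans ((Finset.card_union_le _ _).trans ?_)
  refine Nat.add_le_add_left (card_le_koszulDim_zero _ fun m hm => ?_) _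
  rw [Finset.mem_filter, mem_minGens] at hm
  exact ⟨hm.1.2, hm.2⟩

lemma sum_koszulDim_le_choose {D : Set (Fin n →₀ ℕ)} (hD : IsUpperSet D) (i j : ℕ) (T : Finset ℕ)
    (hT : ∀ t ∈ T, t ≤ i + j) :
    ∑ t ∈ T, koszulDim n (monoPiece k D) i t ≤ (minGens D j).card.choose (i + 1) :=
  (Finset.sum_le_sum fun t ht => koszulDim_le_of_forall_degree_le (multiples_minGens_subset hD j)
    (fun _ => mem_multiples_minGens) (hT t ht)).trans (sum_koszulDim_multiples_le _ _ le_rfl i T)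

variable (mo : MonomialOrder (Fin n))

lemma card_minGens_zero {I : Ideal (MvPolynomial (Fin n) k)} (hI : I ≠ ⊤) :
    (minGens (initialExponents mo I) 0).card = 0 := by
  rw [Finset.card_eq_zero, Finset.eq_empty_iff_forall_notMem]
  intro m hm
  obtain ⟨h0, hmin⟩ := mem_minGens.1 hm
  obtain ⟨f, hf, hf0, rfl⟩ := hmin.prop
  rw [nonpos_iff_eq_zero, Finsupp.degree_eq_zero_iff] at h0
  rw [mo.eq_C_of_degree_eq_zero h0] at hf
  refine hI (I.eq_top_of_isUnit_mem hf ?_)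
  exact (IsUnit.mk0 _ (mo.leadingCoeff_ne_zero_iff.2 hf0)).map C

/-- Each new generator of the initial ideal in degree `d + 1` either comes from a minimal generator
of `I` or is accounted for by a pair of generators of degree at most `d`. -/
lemma card_minGens_initial_succ_le {I : Ideal (MvPolynomial (Fin n) k)}
    (hI : I.IsHomogeneous (homogeneousSubmodule (Fin n) k)) (d : ℕ) :
    (minGens (initialExponents mo I) (d + 1)).card ≤
      (minGens (initialExponents mo I) d).card + betti I hI 0 (d + 1) +
        (minGens (initialExponents mo I) d).card.choose 2 := by
  have h₁ := card_minGens_succ_le k (initialExponents mo I) d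
  have h₂ := koszulDim_zero_initial_le mo I hI (d + 1)
  have h₃ := (standardResolution I hI).koszulDim_zero_le_finrank_Tor (d + 1)
  have h₄ := sum_koszulDim_le_choose (k := k) (isUpperSet_initialExponents mo I) 1 d {d + 1}
    (by simp [add_comm])
  rw [Finset.sum_singleton, one_add_one_eq_two] at h₄
  rw [betti]
  omega

lemma bettiLE_le_choose {I : Ideal (MvPolynomial (Fin n) k)}
    (hI : I.IsHomogeneous (homogeneousSubmodule (Fin n) k)) (i j : ℕ) :
    bettiLE I hI i (i + j) ≤ (minGens (initialExponents mo I) j).card.choose (i + 1) := by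
  refine (Finset.sum_le_sum fun t _ => ((standardResolution I hI).finrank_Tor_le i t).trans
    (koszulDim_idealPiece_le mo hI i t)).trans ?_
  refine sum_koszulDim_le_choose (isUpperSet_initialExponents mo I) i j _ fun t ht => ?_
  rw [Finset.mem_range] at ht
  omega

end Generators

/-- The numerical recursion: if `N₀ = 0` and `N_{d+1} ≤ N_d + β_{d+1} + (N_d choose 2)`, then `N_d`
grows at most doubly exponentially. With `M = h^{2^{a+d+1} - 3}`, the right-hand side is at most
`3 M²`, and `h³ M²` is the next bound. -/
lemma le_pow_of_recursion {a h : ℕ} (ha : 1 ≤ a) (hh : 2 ≤ h) (N β : ℕ → ℕ) (hN : N 0 = 0)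
    (hrec : ∀ d, N (d + 1) ≤ N d + β (d + 1) + (N d).choose 2)
    (hβ : ∀ d, β (d + 1) ≤ h ^ (2 ^ (a + d + 1) - 3)) (d : ℕ) :
    N d ≤ h ^ (2 ^ (a + d + 1) - 3) := by
  induction d with
  | zero =>
    rw [hN]
    exact Nat.zero_le _
  | succ d ih =>
    have hexp : 2 ^ (a + (d + 1) + 1) - 3 = (2 ^ (a + d + 1) - 3) * 2 + 3 := by
      have h4 : 2 ^ 2 ≤ 2 ^ (a + d + 1) := Nat.pow_le_pow_right two_pos (by omega)
      rw [← add_assoc, pow_succ 2 (a + d + 1)]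
      omega
    have hM : 1 ≤ h ^ (2 ^ (a + d + 1) - 3) := Nat.one_le_pow _ _ (by omega)
    rw [hexp, pow_add, pow_mul]
    have hβd := hβ d
    generalize h ^ (2 ^ (a + d + 1) - 3) = M at *
    have hchoose : (N d).choose 2 ≤ M ^ 2 :=
      (Nat.choose_le_pow (N d) 2).trans (Nat.pow_le_pow_left ih 2)
    have h8 : 2 ^ 3 ≤ h ^ 3 := Nat.pow_le_pow_left hh 3
    have hsq : M ≤ M ^ 2 := Nat.le_self_pow two_ne_zero M
    calc N (d + 1) ≤ M ^ 2 + M ^ 2 + M ^ 2 := by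
          have := hrec d
          omega
      _ ≤ M ^ 2 * 2 ^ 3 := by omega
      _ ≤ M ^ 2 * h ^ 3 := Nat.mul_le_mul_left _ h8

end GradedTor

theorem proposition4p6 {k : Type u} [Field k] {n : ℕ}
    (I : Ideal (MvPolynomial (Fin n) k))
    (hI : I.IsHomogeneous (MvPolynomial.homogeneousSubmodule (Fin n) k)) (hI_ne_top : I ≠ ⊤)
    (a h : ℕ) (ha : 1 ≤ a) (hh : 2 ≤ h)
    (hbound : ∀ j : ℕ, (GradedTor.betti I hI 0 j : ℝ) ≤ (h : ℝ) ^ ((2 : ℤ) ^ (j + a) - 3)) :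
    ∀ i j : ℕ, GradedTor.bettiLE I hI i (i + j) ≤ (h ^ (2 ^ (a + j + 1) - 3)).choose (i + 1) := by
  have hβ : ∀ d, GradedTor.betti I hI 0 (d + 1) ≤ h ^ (2 ^ (a + d + 1) - 3) := by
    intro d
    have hb := hbound (d + 1)
    -- In degrees `d + 1 ≥ 1` the integer exponent is positive.
    have h3 : 3 ≤ 2 ^ (a + d + 1) :=
      le_trans (by norm_num) (Nat.pow_le_pow_right two_pos (by omega : 2 ≤ a + d + 1))
    have hexp : (2 : ℤ) ^ (d + 1 + a) - 3 = ((2 ^ (a + d + 1) - 3 : ℕ) : ℤ) := by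
      rw [Nat.cast_sub h3, show d + 1 + a = a + d + 1 by omega]
      norm_num
    rw [hexp, zpow_natCast] at hb
    exact_mod_cast hb
  intro i j
  refine (GradedTor.bettiLE_le_choose MonomialOrder.lex hI i j).trans
    (Nat.choose_le_choose _ ?_)
  have hN := GradedTor.card_minGens_zero MonomialOrder.lex hI_ne_top
  have hrec := GradedTor.card_minGens_initial_succ_le MonomialOrder.lex hI
  generalize GradedTor.betti I hI 0 = β at hβ hrec
  generalize GradedTor.minGens (GradedTor.initialExponents MonomialOrder.lex I) = G at hN hrec ⊢
  exact GradedTor.le_pow_of_recursion ha hh (fun d => (G d).card) β hN hrec hβ j
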